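/- For $a\in\ell^\infty(\mathbb Z,\mathbb C)$ and $b\in\ell^\infty(\mathbb Z,\mathbb R)$ let $J_{a,b}$ be the bounded self-adjoint Jacobi operator on $\ell^2(\mathbb Z,\mathbb C)$, $$(J_{a,b}\psi)(n)=\overline{a_{n-1}}\,\psi(n-1)+a_n\psi(n+1)+b_n\psi(n);$$ some (or all) of the $a_n$ may vanish. Let $\sigma(J_{a,b})$ be its spectrum and $\rho(J_{a,b})=\mathbb C\setminus\sigma(J_{a,b})$. For $E\in\mathbb C$ let $$B^E(j)=\begin{pmatrix}E-b_j&-\overline{a_{j-1}}\\ a_j&0\end{pmatrix},\qquad j\in\mathbb Z .$$ For $B:\mathbb Z\to \mathrm M(2,\mathbb C)$ put $B_n(j)=B(j+n-1)\cdots B(j)$. On $\mathbb C^2$ we use the Euclidean norm and on matrices the operator norm; for lines $V,W\subset\mathbb C^2$ spanned by $v,w$, let $d(V,W)=2|\det(v,w)|/(\|v\|\|w\|)$ (the chordal distance on the Riemann sphere). For an integer $N\ge1$ and reals $\lambda>1$, $\eta>0$, a pair of families of lines $E^u(j),E^s(j)\subset\mathbb C^2$, $j\in\mathbb Z$, is called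 a dominated splitting of $B$ with constants $(N,\lambda,\eta)$ if 1. $B(j)E^u(j)\subseteq E^u(j+1)$ and $B(j)E^s(j)\subseteq E^s(j+1)$ for all $j$; 2. $\|B_N(j)\vec u\|>\lambda\|B_N(j)\vec s\|$ for all $j$ and all unit vectors $\vec u\in E^u(j)$, $\vec s\in E^s(j)$; 3. $d(E^u(j),E^s(j))>\eta$ for all $j$; 4. $\inf_{j\in\mathbb Z}\|B_N(j)\|>0$. A bounded sequence $B$ admits dominated splitting, $B\in\mathcal{DS}$, if it has a dominated splitting for some such constants $(N,\lambda,\eta)$. **Theorem.** For all $a\in\ell^\infty(\mathbb Z,\mathbb C)$ and $b\in\ell^\infty(\mathbb Z,\mathbb R)$, $$\rho(J_{a,b})=\{E\in\mathbb C: B^E\in\mathcal{DS}\}.$$ Moreover, the constants depend only on bounds for the data and on the distance to the spectrum: for all $M>0$ and $\delta>0$ there are $N\ge1$ and $\eta>0$ such that, whenever $\|a\|_\infty\le M$, $\|b\|_\infty\le M$, $|E|\le M$ and $\mathrm{dist}(E,\sigma(J_{a,b}))\ge\delta$, the sequence $B^E$ has a dominated splitting with constants $(N,2,\eta)$. -/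

import Mathlib

open scoped ENNReal ComplexConjugate LinearAlgebra.Projectivization

/-- The Hilbert space `ℓ²(ℤ, ℂ)`. -/
abbrev EllTwo : Type := lp (fun _ : ℤ => ℂ) 2

/-- The Euclidean plane `ℂ²`. -/
abbrev C2 : Type := EuclideanSpace ℂ (Fin 2)

lemma weightedShift_memlp (c : ℤ → ℂ) (C : ℝ) (hc : ∀ n, ‖c n‖ ≤ C) (k : ℤ) (ψ : EllTwo) :
    Memℓp (fun n : ℤ => c n * ψ (n + k)) 2 := by
  have hC : 0 ≤ C := (norm_nonneg _).trans (hc 0)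
  have hs : Summable fun n : ℤ => ‖ψ n‖ ^ (2 : ℝ) := by
    simpa using (lp.memℓp ψ).summable (by norm_num)
  have hs' : Summable fun n : ℤ => C ^ (2 : ℝ) * ‖ψ (n + k)‖ ^ (2 : ℝ) :=
    ((Equiv.addRight k).summable_iff.mpr hs).mul_left _
  refine memℓp_gen (Summable.of_nonneg_of_le (fun n => by positivity) (fun n => ?_) hs')
  rw [← Real.mul_rpow hC (norm_nonneg _), norm_mul]
  simp only [ENNReal.toReal_ofNat]
  gcongr
  exact hc n

lemma weightedShift_norm_le (c : ℤ → ℂ) (C : ℝ) (hc : ∀ n, ‖c n‖ ≤ C) (k : ℤ) (ψ : EllTwo) :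
    ‖(⟨fun n : ℤ => c n * ψ (n + k), weightedShift_memlp c C hc k ψ⟩ : EllTwo)‖ ≤ C * ‖ψ‖ := by
  have hC : 0 ≤ C := (norm_nonneg _).trans (hc 0)
  have h2 : (0 : ℝ) < (2 : ℝ≥0∞).toReal := by norm_num
  have hs : Summable fun n : ℤ => ‖ψ n‖ ^ (2 : ℝ≥0∞).toReal :=
    (lp.memℓp ψ).summable h2
  have hs' : Summable fun n : ℤ => ‖ψ (n + k)‖ ^ (2 : ℝ≥0∞).toReal :=
    (Equiv.addRight k).summable_iff.mpr hs
  refine lp.norm_le_of_tsum_le h2 (by positivity) ?_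
  rw [Real.mul_rpow hC (norm_nonneg _), lp.norm_rpow_eq_tsum h2 ψ,
    ← (Equiv.addRight k).tsum_eq (fun n : ℤ => ‖ψ n‖ ^ (2 : ℝ≥0∞).toReal), ← tsum_mul_left]
  have hle : ∀ n : ℤ, ‖c n * ψ (n + k)‖ ^ (2 : ℝ≥0∞).toReal
      ≤ C ^ (2 : ℝ≥0∞).toReal * ‖ψ (n + k)‖ ^ (2 : ℝ≥0∞).toReal := by
    intro n
    rw [← Real.mul_rpow hC (norm_nonneg _), norm_mul]
    gcongr
    exact hc n
  exact Summable.tsum_le_tsum hle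
    (Summable.of_nonneg_of_le (fun n => by positivity) hle (hs'.mul_left _)) (hs'.mul_left _)

/-- The bounded operator `(W ψ)(n) = c n * ψ (n + k)` on `ℓ²(ℤ, ℂ)`, for a bounded sequence `c`. -/
noncomputable def weightedShift (c : ℤ → ℂ) (C : ℝ) (hc : ∀ n, ‖c n‖ ≤ C) (k : ℤ) :
    EllTwo →L[ℂ] EllTwo :=
  LinearMap.mkContinuous
    { toFun := fun ψ => ⟨fun n : ℤ => c n * ψ (n + k), weightedShift_memlp c C hc k ψ⟩
      map_add' := fun ψ φ => by
        ext n
        exact mul_add _ _ _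
      map_smul' := fun z ψ => by
        ext n
        simp [mul_left_comm] }
    C (weightedShift_norm_le c C hc k)

/-- The Jacobi operator
`(J_{a,b} ψ)(n) = conj (a (n-1)) * ψ (n-1) + a n * ψ (n+1) + b n * ψ n` on `ℓ²(ℤ, ℂ)`. -/
noncomputable def jacobiOp (a : lp (fun _ : ℤ => ℂ) ∞) (b : lp (fun _ : ℤ => ℝ) ∞) :
    EllTwo →L[ℂ] EllTwo :=
  weightedShift (fun n => conj (a (n - 1))) ‖a‖
      (fun n => by simpa using lp.norm_apply_le_norm ENNReal.top_ne_zero a (n - 1)) (-1)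
    + weightedShift (fun n => a n) ‖a‖
      (fun n => lp.norm_apply_le_norm ENNReal.top_ne_zero a n) 1
    + weightedShift (fun n => (b n : ℂ)) ‖b‖
      (fun n => by
        simpa using lp.norm_apply_le_norm ENNReal.top_ne_zero b n) 0

lemma jacobiOp_apply (a : lp (fun _ : ℤ => ℂ) ∞) (b : lp (fun _ : ℤ => ℝ) ∞) (ψ : EllTwo)
    (n : ℤ) :
    jacobiOp a b ψ n = conj (a (n - 1)) * ψ (n - 1) + a n * ψ (n + 1) + (b n : ℂ) * ψ n := by
  have h : jacobiOp a b ψ n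
      = conj (a (n - 1)) * ψ (n + -1) + a n * ψ (n + 1) + (b n : ℂ) * ψ (n + 0) := rfl
  rw [h, add_zero, ← sub_eq_add_neg]

/-- The Jacobi cocycle map `B^E : ℤ → M(2, ℂ)`. -/
noncomputable def jacobiCocycle (a : lp (fun _ : ℤ => ℂ) ∞) (b : lp (fun _ : ℤ => ℝ) ∞)
    (E : ℂ) (j : ℤ) : Matrix (Fin 2) (Fin 2) ℂ :=
  !![E - (b j : ℂ), -conj (a (j - 1)); a j, 0]

/-- `B_n(j) = B(j+n-1) ⋯ B(j)` for `n ≥ 1`, and `B_0(j) = I`. -/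
noncomputable def cocycleIter (B : ℤ → Matrix (Fin 2) (Fin 2) ℂ) :
    ℕ → ℤ → Matrix (Fin 2) (Fin 2) ℂ
  | 0, _ => 1
  | n + 1, j => B (j + n) * cocycleIter B n j

/-- The projection `ℂ² ∖ {0} → ℂ ∪ {∞}`, `(z₁, z₂) ↦ z₂ / z₁`. -/
noncomputable def projCP1 (v : C2) : OnePoint ℂ :=
  open Classical in if v 0 = 0 then OnePoint.infty else ((v 1 / v 0 : ℂ) : OnePoint ℂ)

/-- The chordal metric on the Riemann sphere. -/
noncomputable def chordalDist : OnePoint ℂ → OnePoint ℂ → ℝ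
  | some z, some w => 2 * ‖z - w‖ / Real.sqrt ((1 + ‖z‖ ^ 2) * (1 + ‖w‖ ^ 2))
  | some z, none => 2 / Real.sqrt (1 + ‖z‖ ^ 2)
  | none, some w => 2 / Real.sqrt (1 + ‖w‖ ^ 2)
  | none, none => 0

/-- The distance `d(V, W) = d(π(v), π(w))` of two lines `V`, `W` in `ℂ²`, where `v ∈ V` and
`w ∈ W` are nonzero vectors; by `lineDist_eq` it does not depend on their choice. -/
noncomputable def lineDist (V W : ℙ ℂ C2) : ℝ :=
  chordalDist (projCP1 V.rep) (projCP1 W.rep)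

lemma chordalDist_projCP1 (v w : C2) (hv : v ≠ 0) (hw : w ≠ 0) :
    chordalDist (projCP1 v) (projCP1 w) = 2 * ‖v 0 * w 1 - v 1 * w 0‖ / (‖v‖ * ‖w‖) := by
  have key : ∀ u : C2, u 0 ≠ 0 → Real.sqrt (1 + ‖u 1 / u 0‖ ^ 2) = ‖u‖ / ‖u 0‖ := by
    intro u hu
    have hp : 0 < ‖u 0‖ := norm_pos_iff.mpr hu
    rw [EuclideanSpace.norm_eq, Fin.sum_univ_two, ← Real.sqrt_sq hp.le,
      ← Real.sqrt_div (by positivity), Real.sqrt_sq hp.le, norm_div]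
    congr 1
    field_simp
  have key0 : ∀ u : C2, u 0 = 0 → ‖u‖ = ‖u 1‖ := by
    intro u hu
    rw [EuclideanSpace.norm_eq, Fin.sum_univ_two, hu]
    simp
  have hv' : 0 < ‖v‖ := norm_pos_iff.mpr hv
  have hw' : 0 < ‖w‖ := norm_pos_iff.mpr hw
  by_cases h0 : v 0 = 0 <;> by_cases k0 : w 0 = 0
  · simp only [projCP1, h0, k0, if_true]
    change (0 : ℝ) = _
    simp
  · simp only [projCP1, h0, k0, if_true, if_false]
    change 2 / Real.sqrt (1 + ‖w 1 / w 0‖ ^ 2) = _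
    have hp : 0 < ‖w 0‖ := norm_pos_iff.mpr k0
    rw [key w k0, key0 v h0]
    have := key0 v h0
    rw [this] at hv'
    simp only [zero_mul, zero_sub, norm_neg, norm_mul]
    field_simp
  · simp only [projCP1, h0, k0, if_true, if_false]
    change 2 / Real.sqrt (1 + ‖v 1 / v 0‖ ^ 2) = _
    have hp : 0 < ‖v 0‖ := norm_pos_iff.mpr h0
    rw [key v h0, key0 w k0]
    have := key0 w k0
    rw [this] at hw'
    simp only [mul_zero, sub_zero, norm_mul]
    field_simp
  · simp only [projCP1, h0, k0, if_false]
    change 2 * ‖v 1 / v 0 - w 1 / w 0‖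
      / Real.sqrt ((1 + ‖v 1 / v 0‖ ^ 2) * (1 + ‖w 1 / w 0‖ ^ 2)) = _
    have hp : 0 < ‖v 0‖ := norm_pos_iff.mpr h0
    have hq : 0 < ‖w 0‖ := norm_pos_iff.mpr k0
    rw [Real.sqrt_mul (by positivity), key v h0, key w k0, div_sub_div _ _ h0 k0, norm_div,
      norm_mul (v 0) (w 0), norm_sub_rev (v 1 * w 0)]
    field_simp

lemma lineDist_eq (V W : ℙ ℂ C2) (v w : C2) (hv : v ≠ 0) (hw : w ≠ 0)
    (hvV : v ∈ V.submodule) (hwW : w ∈ W.submodule) :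
    lineDist V W = chordalDist (projCP1 v) (projCP1 w) := by
  have key : ∀ (U : ℙ ℂ C2) (u : C2), u ≠ 0 → u ∈ U.submodule →
      projCP1 u = projCP1 U.rep := by
    intro U u hu hU
    rw [Projectivization.submodule_eq, Submodule.mem_span_singleton] at hU
    obtain ⟨c, rfl⟩ := hU
    have hc : c ≠ 0 := by
      rintro rfl
      simp at hu
    by_cases h0 : U.rep 0 = 0
    · simp [projCP1, h0]
    · simp [projCP1, h0, hc, mul_div_mul_left]
  rw [lineDist, key V v hv hvV, key W w hw hwW]

/-- `E^u`, `E^s` form a dominated splitting of the sequence `B`, with step `N` and factor `lam` in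
the domination condition and with separation `δ`. -/
structure IsDominatedSplitting (B : ℤ → Matrix (Fin 2) (Fin 2) ℂ) (Eu Es : ℤ → ℙ ℂ C2)
    (N : ℕ) (lam δ : ℝ) : Prop where
  invariant_u : ∀ j, (Eu j).submodule.map (Matrix.toEuclideanLin (B j)) ≤ (Eu (j + 1)).submodule
  invariant_s : ∀ j, (Es j).submodule.map (Matrix.toEuclideanLin (B j)) ≤ (Es (j + 1)).submodule
  domination : ∀ j, ∀ u ∈ (Eu j).submodule, ∀ s ∈ (Es j).submodule, ‖u‖ = 1 → ‖s‖ = 1 →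
    lam * ‖Matrix.toEuclideanLin (cocycleIter B N j) s‖
      < ‖Matrix.toEuclideanLin (cocycleIter B N j) u‖
  separation : ∀ j, δ < lineDist (Eu j) (Es j)
  /-- `inf_j ‖B_N(j)‖ > 0`, in the operator norm of the Euclidean norm on `ℂ²`. -/
  norm_lower : ∃ m : ℝ, 0 < m ∧
    ∀ j, m ≤ ‖Matrix.toEuclideanCLM (n := Fin 2) (𝕜 := ℂ) (cocycleIter B N j)‖

/-- The bounded sequence `B : ℤ → M(2, ℂ)` admits dominated splitting. -/
def AdmitsDominatedSplitting (B : ℤ → Matrix (Fin 2) (Fin 2) ℂ) : Prop :=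
  (∃ C : ℝ, ∀ j, ‖Matrix.toEuclideanCLM (n := Fin 2) (𝕜 := ℂ) (B j)‖ ≤ C) ∧
  ∃ (Eu Es : ℤ → ℙ ℂ C2) (N : ℕ) (lam δ : ℝ), 0 < N ∧ 1 < lam ∧ 0 < δ ∧
    IsDominatedSplitting B Eu Es N lam δ

/-! Write T = J - E, a normal operator. The lines are the values (ψ(j), ψ(j-1)) of half-line
solutions: square-summable ψ with Tψ = 0 on [j, ∞) for E^s(j), and on (-∞, j-1] for E^u(j).

Resolvent to splitting. If E is at distance at least δ from the spectrum, normality gives ‖Tψ‖ ≥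
δ‖ψ‖. Gluing a stable to an unstable solution at j leaves a defect only at j-1 and j, of size
|a_{j-1}| times the mismatch of the two pairs (`norm_sq_jacobiSub_glue`). Hence the glued sequence
is at most M/δ times the mismatch. This gives the angle between the lines (`norm_sq_pairAt_le_sub`)
and, gluing with zero, exponential decay of half-line solutions (`stableSol_decay`,
`unstableSol_decay`). Nothing is divided by a_n: B multiplies stable pairs by a_j, while an unstable
solution is carried to one that equals a_jψ on the past. Over N steps both estimates contain the
same product of a's, which drops out of the comparison even if it is zero. Truncating an unstable
solution shows that B expands E^u at least by δ, whence the lower bound on ‖B_N‖. Neither line is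
trivial, by an argument on the columns T⁻¹δ_m of the Green function. All constants come from K =
(M/δ)².

Splitting to resolvent. Let u, s be unit frames with multipliers α, β; condition 4 keeps |α| away
from zero (`AdmitsDominatedSplitting.exists_frame`). The coordinates of (ψ(n), ψ(n-1)) along u and s
satisfy scalar first-order recursions with source Tψ and weights x, y, where xy = β/α. Domination
makes products of xy decay. Products of x and of shifted y are comparable, so each decays separately
(`exists_prod_le_half`), and truncated Neumann series bound ψ by Tψ. A normal operator bounded below
is invertible. -/

/-! ### Normality of J - E and its lower bound -/

lemma weightedShift_apply (c : ℤ → ℂ) (C : ℝ) (hc : ∀ n, ‖c n‖ ≤ C) (k : ℤ) (ψ : EllTwo) (n : ℤ) :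
    weightedShift c C hc k ψ n = c n * ψ (n + k) := rfl

lemma weightedShift_inner (c : ℤ → ℂ) (C : ℝ) (hc : ∀ n, ‖c n‖ ≤ C) (c' : ℤ → ℂ) (C' : ℝ)
    (hc' : ∀ n, ‖c' n‖ ≤ C') (k k' : ℤ) (hk : k + k' = 0) (h : ∀ n, c' (n + k) = conj (c n))
    (x y : EllTwo) :
    inner ℂ x (weightedShift c C hc k y) = inner ℂ (weightedShift c' C' hc' k' x) y := by
  rw [lp.inner_eq_tsum, lp.inner_eq_tsum,
    ← (Equiv.addRight k).tsum_eq (fun n => inner ℂ (weightedShift c' C' hc' k' x n) (y n))]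
  refine tsum_congr fun n => ?_
  simp only [weightedShift_apply, Equiv.coe_addRight, h, RCLike.inner_apply, map_mul,
    RCLike.conj_conj, add_assoc, hk, add_zero]
  ring

lemma jacobiOp_isSelfAdjoint (a : lp (fun _ : ℤ => ℂ) ∞) (b : lp (fun _ : ℤ => ℝ) ∞) :
    IsSelfAdjoint (jacobiOp a b) := by
  rw [ContinuousLinearMap.isSelfAdjoint_iff_isSymmetric]
  intro x y
  simp only [jacobiOp, ContinuousLinearMap.coe_coe, add_apply, inner_add_left,
    inner_add_right]
  symm
  rw [add_comm (inner ℂ (weightedShift (fun n => conj (a (n - 1))) _ _ (-1) x) y)]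
  congr 1
  · congr 1
    · exact weightedShift_inner _ _ _ _ _ _ _ _ (by norm_num) (fun n => by simp [sub_eq_add_neg]) _ _
    · exact weightedShift_inner _ _ _ _ _ _ _ _ (by norm_num) (fun n => by simp) _ _
  · exact weightedShift_inner _ _ _ _ _ _ _ _ (by norm_num) (fun n => by simp) _ _

/-- The operator `J_{a,b} - E`. -/
noncomputable def jacobiSub (a : lp (fun _ : ℤ => ℂ) ∞) (b : lp (fun _ : ℤ => ℝ) ∞) (E : ℂ) :
    EllTwo →L[ℂ] EllTwo :=
  jacobiOp a b - E • 1

lemma jacobiSub_apply (a : lp (fun _ : ℤ => ℂ) ∞) (b : lp (fun _ : ℤ => ℝ) ∞) (E : ℂ) (ψ : EllTwo)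
    (n : ℤ) : jacobiSub a b E ψ n =
      conj (a (n - 1)) * ψ (n - 1) + a n * ψ (n + 1) + ((b n : ℂ) - E) * ψ n := by
  have h : jacobiSub a b E ψ n = jacobiOp a b ψ n - E * ψ n := rfl
  rw [h, jacobiOp_apply]
  ring

lemma jacobiSub_isStarNormal (a : lp (fun _ : ℤ => ℂ) ∞) (b : lp (fun _ : ℤ => ℝ) ∞) (E : ℂ) :
    IsStarNormal (jacobiSub a b E) := by
  have h := (jacobiOp_isSelfAdjoint a b).star_eq
  constructor
  simp only [jacobiSub, star_sub, h, star_smul, star_one]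
  apply Commute.sub_left <;> apply Commute.sub_right
  · exact Commute.refl _
  · exact (Commute.one_right _).smul_right _
  · exact (Commute.one_left _).smul_left _
  · exact ((Commute.one_left _).smul_left _).smul_right _

lemma jacobiSub_inner (a : lp (fun _ : ℤ => ℂ) ∞) (b : lp (fun _ : ℤ => ℝ) ∞) (E : ℂ)
    (x y : EllTwo) : inner ℂ (jacobiSub a b E x) y = inner ℂ x (jacobiSub a b (conj E) y) := by
  have h := (ContinuousLinearMap.isSelfAdjoint_iff_isSymmetric.mp (jacobiOp_isSelfAdjoint a b)) x y
  simp only [ContinuousLinearMap.coe_coe] at h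
  simp only [jacobiSub, sub_apply, smul_apply,
    one_apply_eq_self, inner_sub_left, inner_sub_right, h, inner_smul_left,
    inner_smul_right]

lemma mem_resolventSet_iff_isUnit_jacobiSub (a : lp (fun _ : ℤ => ℂ) ∞)
    (b : lp (fun _ : ℤ => ℝ) ∞) (E : ℂ) :
    E ∈ resolventSet ℂ (jacobiOp a b) ↔ IsUnit (jacobiSub a b E) := by
  rw [spectrum.mem_resolventSet_iff, ← IsUnit.neg_iff, Algebra.algebraMap_eq_smul_one, neg_sub,
    jacobiSub]

/-- A normal operator that is bounded below is invertible. -/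
lemma IsStarNormal.isUnit_of_bounded_below {H : Type*} [NormedAddCommGroup H]
    [InnerProductSpace ℂ H] [CompleteSpace H] {T : H →L[ℂ] H} (hT : IsStarNormal T) {c : ℝ}
    (hc : 0 < c) (h : ∀ x, c * ‖x‖ ≤ ‖T x‖) : IsUnit T := by
  have hker : LinearMap.ker (T : H →ₗ[ℂ] H) = ⊥ := by
    rw [LinearMap.ker_eq_bot']
    intro x hx
    have h1 := h x
    simp only [ContinuousLinearMap.coe_coe] at hx
    rw [hx, norm_zero] at h1
    by_contra hne
    have := mul_pos hc (norm_pos_iff.mpr hne)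
    linarith
  have hanti : AntilipschitzWith (Real.toNNReal c⁻¹) T := by
    refine AddMonoidHomClass.antilipschitz_of_bound T fun x => ?_
    rw [Real.coe_toNNReal _ (by positivity), inv_mul_eq_div, le_div_iff₀ hc]
    linarith [h x]
  have hclosed : IsClosed (Set.range T) := hanti.isClosed_range T.uniformContinuous
  have htop : LinearMap.range (T : H →ₗ[ℂ] H) = ⊤ := by
    -- For a normal operator the complement of the range is the kernel, here trivial; the closed
    -- range is therefore everything.
    have h1 := ContinuousLinearMap.IsStarNormal.orthogonal_range hT
    have h2 : IsClosed ((LinearMap.range (T : H →ₗ[ℂ] H) : Submodule ℂ H) : Set H) := by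
      rw [LinearMap.coe_range]
      exact hclosed
    have : CompleteSpace (LinearMap.range (T : H →ₗ[ℂ] H)) := h2.completeSpace_coe
    rw [← Submodule.orthogonal_eq_bot_iff]
    rw [← hker]
    exact h1
  rw [ContinuousLinearMap.isUnit_iff_bijective]
  exact ⟨LinearMap.ker_eq_bot.mp hker, LinearMap.range_eq_top.mp htop⟩

lemma isUnit_of_infDist_spectrum_pos (a : lp (fun _ : ℤ => ℂ) ∞) (b : lp (fun _ : ℤ => ℝ) ∞)
    (E : ℂ) (h : 0 < Metric.infDist E (spectrum ℂ (jacobiOp a b))) :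
    IsUnit (jacobiSub a b E) := by
  rw [← mem_resolventSet_iff_isUnit_jacobiSub]
  by_contra hE
  have : E ∈ spectrum ℂ (jacobiOp a b) := hE
  rw [Metric.infDist_zero_of_mem this] at h
  exact lt_irrefl _ h

/-- The inverse is normal too, so its norm equals its spectral radius, which spectral mapping bounds
by δ⁻¹. -/
lemma norm_le_of_le_infDist_spectrum (a : lp (fun _ : ℤ => ℂ) ∞) (b : lp (fun _ : ℤ => ℝ) ∞)
    (E : ℂ) {δ : ℝ} (hδ : 0 < δ) (h : δ ≤ Metric.infDist E (spectrum ℂ (jacobiOp a b)))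
    (ψ : EllTwo) : δ * ‖ψ‖ ≤ ‖jacobiSub a b E ψ‖ := by
  obtain ⟨u, hu⟩ := isUnit_of_infDist_spectrum_pos a b E (hδ.trans_le h)
  have hnormal : IsStarNormal (u : EllTwo →L[ℂ] EllTwo) := hu ▸ jacobiSub_isStarNormal a b E
  have hinv : IsStarNormal ((u⁻¹ : (EllTwo →L[ℂ] EllTwo)ˣ) : EllTwo →L[ℂ] EllTwo) := by
    have h1 : Commute (↑(star u) : EllTwo →L[ℂ] EllTwo) (u : EllTwo →L[ℂ] EllTwo) :=
      hnormal.star_comm_self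
    constructor
    have h2 := h1.units_inv_left.units_inv_right
    rwa [← star_inv] at h2
  have hrad : spectralRadius ℂ ((u⁻¹ : (EllTwo →L[ℂ] EllTwo)ˣ) : EllTwo →L[ℂ] EllTwo) ≤
      ((Real.toNNReal δ⁻¹ : NNReal) : ℝ≥0∞) := by
    refine iSup₂_le fun z hz => ?_
    rw [← spectrum.map_inv, Set.mem_inv, hu] at hz
    have hz' : z⁻¹ + E ∈ spectrum ℂ (jacobiOp a b) := by
      rwa [spectrum.add_mem_iff, Algebra.algebraMap_eq_smul_one, neg_add_eq_sub]
    have hd : δ ≤ ‖z⁻¹‖ := by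
      have := h.trans (Metric.infDist_le_dist_of_mem hz')
      rwa [dist_comm, dist_eq_norm, add_sub_cancel_right] at this
    have hz0 : ‖z‖ ≤ δ⁻¹ := by
      rw [norm_inv] at hd
      exact (le_inv_comm₀ hδ (inv_pos.mp (hδ.trans_le hd))).mp hd
    rw [ENNReal.coe_le_coe, ← NNReal.coe_le_coe, Real.coe_toNNReal _ (by positivity)]
    exact hz0
  rw [IsStarNormal.spectralRadius_eq_nnnorm, ENNReal.coe_le_coe, ← NNReal.coe_le_coe,
    Real.coe_toNNReal _ (by positivity), coe_nnnorm] at hrad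
  have h4 : ψ = (u⁻¹ : (EllTwo →L[ℂ] EllTwo)ˣ).val (u.val ψ) := by
    rw [← mul_apply_eq_comp, Units.inv_mul, one_apply_eq_self]
  have h5 := ContinuousLinearMap.le_of_opNorm_le _ hrad (u.val ψ)
  rw [← h4, hu, inv_mul_eq_div, le_div_iff₀ hδ] at h5
  linarith

/-! ### Cutting, gluing and pairs of neighbouring values -/

lemma EllTwo.norm_sq_eq_add {φ χ : EllTwo} {n : ℤ} (h : ∀ m, m ≠ n → φ m = χ m) (h0 : χ n = 0) :
    ‖φ‖ ^ 2 = ‖φ n‖ ^ 2 + ‖χ‖ ^ 2 := by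
  have hφ : φ = lp.single 2 n (φ n) + χ := by
    ext m
    by_cases hm : m = n
    · subst hm
      simp [h0]
    · simp [hm, h m hm]
  have horth : inner ℂ (lp.single 2 n (φ n) : EllTwo) χ = 0 := by
    rw [lp.inner_single_left, h0, inner_zero_right]
  have := norm_add_sq_eq_norm_sq_add_norm_sq_of_inner_eq_zero _ _ horth
  rw [← hφ, lp.norm_single (by norm_num)] at this
  simpa [sq] using this

/-- The sequence equal to `ψ` on `[n, ∞)` and to `χ` on `(-∞, n)`. -/
noncomputable def glue (n : ℤ) (ψ χ : EllTwo) : EllTwo :=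
  open Classical in
  weightedShift (fun m => if n ≤ m then 1 else 0) 1 (fun m => by split_ifs <;> simp) 0 ψ +
    weightedShift (fun m => if n ≤ m then 0 else 1) 1 (fun m => by split_ifs <;> simp) 0 χ

lemma glue_of_le {n m : ℤ} (h : n ≤ m) (ψ χ : EllTwo) : glue n ψ χ m = ψ m := by
  simp [glue, weightedShift_apply, h]

lemma glue_of_lt {n m : ℤ} (h : m < n) (ψ χ : EllTwo) : glue n ψ χ m = χ m := by
  simp [glue, weightedShift_apply, not_le.mpr h]

lemma EllTwo.norm_sq_of_support_pair {φ : EllTwo} {m n : ℤ} (hmn : m ≠ n)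
    (h : ∀ k, k ≠ m → k ≠ n → φ k = 0) : ‖φ‖ ^ 2 = ‖φ m‖ ^ 2 + ‖φ n‖ ^ 2 := by
  rw [EllTwo.norm_sq_eq_add (n := m) (χ := lp.single 2 n (φ n)), lp.norm_single (by norm_num)]
  · intro k hk
    by_cases hkn : k = n
    · subst hkn
      simp
    · simp [hkn, h k hk hkn]
  · simp [hmn]

lemma EllTwo.add_sq_le_norm_sq (φ : EllTwo) {m n : ℤ} (hmn : m ≠ n) :
    ‖φ m‖ ^ 2 + ‖φ n‖ ^ 2 ≤ ‖φ‖ ^ 2 := by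
  set χ : EllTwo := φ - lp.single 2 m (φ m) with hχ
  have h1 := EllTwo.norm_sq_eq_add (φ := φ) (χ := χ) (n := m)
    (fun k hk => by simp [hχ, hk]) (by simp [hχ])
  have h2 : χ n = φ n := by simp [hχ, hmn.symm]
  have h3 := lp.norm_apply_le_norm (p := 2) (by norm_num) χ n
  rw [h2] at h3
  rw [h1]
  gcongr

/-- The vector `(ψ(j), ψ(j-1))`. -/
noncomputable def pairAt (j : ℤ) : EllTwo →ₗ[ℂ] C2 where
  toFun ψ := !₂[ψ j, ψ (j - 1)]
  map_add' ψ χ := by ext i; fin_cases i <;> simp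
  map_smul' c ψ := by ext i; fin_cases i <;> simp

@[simp] lemma pairAt_zero (j : ℤ) (ψ : EllTwo) : pairAt j ψ 0 = ψ j := rfl
@[simp] lemma pairAt_one (j : ℤ) (ψ : EllTwo) : pairAt j ψ 1 = ψ (j - 1) := rfl

lemma C2.norm_sq (v : C2) : ‖v‖ ^ 2 = ‖v 0‖ ^ 2 + ‖v 1‖ ^ 2 := by
  rw [EuclideanSpace.norm_sq_eq, Fin.sum_univ_two]

lemma norm_sq_pairAt_le (j : ℤ) (ψ : EllTwo) : ‖pairAt j ψ‖ ^ 2 ≤ ‖ψ‖ ^ 2 := by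
  rw [C2.norm_sq]
  exact EllTwo.add_sq_le_norm_sq ψ (by omega)

/-! ### Half-line solutions: transversality and decay -/

section

variable (a : lp (fun _ : ℤ => ℂ) ∞) (b : lp (fun _ : ℤ => ℝ) ∞) (E : ℂ)

/-- The square summable sequences that solve `J ψ = E ψ` on `[j, ∞)`. -/
noncomputable def stableSol (j : ℤ) : Submodule ℂ EllTwo where
  carrier := {ψ | ∀ n, j ≤ n → jacobiSub a b E ψ n = 0}
  add_mem' hx hy n hn := by simp [hx n hn, hy n hn]
  zero_mem' n _ := by simp
  smul_mem' c x hx n hn := by simp [hx n hn]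

/-- The square summable sequences that solve `J ψ = E ψ` on `(-∞, j - 1]`. -/
noncomputable def unstableSol (j : ℤ) : Submodule ℂ EllTwo where
  carrier := {ψ | ∀ n, n < j → jacobiSub a b E ψ n = 0}
  add_mem' hx hy n hn := by simp [hx n hn, hy n hn]
  zero_mem' n _ := by simp
  smul_mem' c x hx n hn := by simp [hx n hn]

variable {a b E}

/-- Away from `j - 1` and `j` the three-term stencil sees only one of the two sequences; at these
sites it sees one value from the wrong side, weighted by `a (j - 1)` or its conjugate. -/
lemma norm_sq_jacobiSub_glue {j : ℤ} {ψ χ : EllTwo} (hψ : ψ ∈ stableSol a b E j)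
    (hχ : χ ∈ unstableSol a b E j) :
    ‖jacobiSub a b E (glue j ψ χ)‖ ^ 2 = ‖a (j - 1)‖ ^ 2 * ‖pairAt j ψ - pairAt j χ‖ ^ 2 := by
  have h0 : jacobiSub a b E (glue j ψ χ) j = conj (a (j - 1)) * (χ (j - 1) - ψ (j - 1)) := by
    have h := hψ j le_rfl
    rw [jacobiSub_apply] at h ⊢
    rw [glue_of_lt (by omega), glue_of_le (by omega), glue_of_le (by omega)]
    linear_combination h
  have h1 : jacobiSub a b E (glue j ψ χ) (j - 1) = a (j - 1) * (ψ j - χ j) := by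
    have h := hχ (j - 1) (by omega)
    rw [jacobiSub_apply] at h ⊢
    rw [glue_of_lt (by omega), glue_of_le (by omega), glue_of_lt (by omega)]
    rw [sub_add_cancel] at *
    linear_combination h
  rw [EllTwo.norm_sq_of_support_pair (m := j) (n := j - 1) (by omega), h0, h1, C2.norm_sq]
  · simp only [norm_mul, RCLike.norm_conj, PiLp.sub_apply, pairAt_zero, pairAt_one]
    rw [norm_sub_rev (χ (j - 1))]
    ring
  · intro k hk hk'
    rcases lt_or_ge k j with h | h
    · have := hχ k h
      rw [jacobiSub_apply] at this ⊢
      rwa [glue_of_lt (by omega), glue_of_lt (by omega), glue_of_lt (by omega)]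
    · have := hψ k h
      rw [jacobiSub_apply] at this ⊢
      rwa [glue_of_le (by omega), glue_of_le (by omega), glue_of_le (by omega)]

lemma norm_sq_glue_le {M δ : ℝ} (hδ : 0 < δ) (ha : ‖a‖ ≤ M)
    (hT : ∀ ψ, δ * ‖ψ‖ ≤ ‖jacobiSub a b E ψ‖) {j : ℤ} {ψ χ : EllTwo}
    (hψ : ψ ∈ stableSol a b E j) (hχ : χ ∈ unstableSol a b E j) :
    ‖glue j ψ χ‖ ^ 2 ≤ (M / δ) ^ 2 * ‖pairAt j ψ - pairAt j χ‖ ^ 2 := by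
  have h1 : ‖a (j - 1)‖ ≤ M := (lp.norm_apply_le_norm ENNReal.top_ne_zero a _).trans ha
  have h2 : (δ * ‖glue j ψ χ‖) ^ 2 ≤ M ^ 2 * ‖pairAt j ψ - pairAt j χ‖ ^ 2 :=
    calc _ ≤ ‖jacobiSub a b E (glue j ψ χ)‖ ^ 2 := by gcongr; exact hT _
      _ = _ := norm_sq_jacobiSub_glue hψ hχ
      _ ≤ _ := by gcongr
  rw [div_pow, div_mul_eq_mul_div, le_div_iff₀ (by positivity)]
  linarith

lemma norm_sq_pairAt_le_sub {M δ : ℝ} (hδ : 0 < δ) (ha : ‖a‖ ≤ M)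
    (hT : ∀ ψ, δ * ‖ψ‖ ≤ ‖jacobiSub a b E ψ‖) {j : ℤ} {ψ χ : EllTwo}
    (hψ : ψ ∈ stableSol a b E j) (hχ : χ ∈ unstableSol a b E j) :
    ‖pairAt j ψ‖ ^ 2 ≤ (2 * (M / δ) ^ 2 + 2) * ‖pairAt j ψ - pairAt j χ‖ ^ 2 := by
  have h1 := norm_sq_glue_le hδ ha hT hψ hχ
  have h2 := norm_sq_pairAt_le j (glue j ψ χ)
  -- The glued pair is (s₀, u₁), so s₀ and u₁ are controlled by s - u; then s₁ = u₁ + (s - u)₁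
  -- yields the constant 2K + 2.
  have e1 : pairAt j (glue j ψ χ) 0 = pairAt j ψ 0 := glue_of_le le_rfl _ _
  have e2 : pairAt j (glue j ψ χ) 1 = pairAt j χ 1 := glue_of_lt (by omega) _ _
  set s := pairAt j ψ
  set u := pairAt j χ
  have h3 : ‖s 1‖ ≤ ‖u 1‖ + ‖(s - u) 1‖ := by
    have : s 1 = u 1 + (s - u) 1 := by simp
    calc ‖s 1‖ = ‖u 1 + (s - u) 1‖ := by rw [← this]
      _ ≤ _ := norm_add_le _ _
  rw [C2.norm_sq, e1, e2] at h2
  have h4 : ‖(s - u) 1‖ ^ 2 ≤ ‖s - u‖ ^ 2 := by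
    rw [C2.norm_sq (s - u)]
    nlinarith [sq_nonneg ‖(s - u) 0‖]
  have h5 : ‖s 1‖ ^ 2 ≤ (‖u 1‖ + ‖(s - u) 1‖) ^ 2 := by gcongr
  rw [C2.norm_sq s]
  nlinarith [sq_nonneg (‖u 1‖ - ‖(s - u) 1‖), sq_nonneg ‖s 0‖]

/-- Monotonicity replaces t(k+1) by t(k+2) on the left, so (1 + K) t(k+2) ≤ K t(k). -/
lemma pow_mul_of_tail_recursion {K : ℝ} (hK : 0 ≤ K) {t : ℕ → ℝ} (hanti : Antitone t)
    (h : ∀ k, t (k + 1) ≤ K * (t k - t (k + 2))) (r : ℕ) :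
    t (2 * r) ≤ (K / (1 + K)) ^ r * t 0 := by
  induction r with
  | zero => simp
  | succ r ih =>
    have h1 := h (2 * r)
    have h2 : t (2 * r + 2) ≤ t (2 * r + 1) := hanti (by omega)
    have h3 : t (2 * r + 2) ≤ K / (1 + K) * t (2 * r) := by
      rw [div_mul_eq_mul_div, le_div_iff₀ (by positivity)]
      linarith
    calc t (2 * (r + 1)) ≤ K / (1 + K) * t (2 * r) := h3
      _ ≤ K / (1 + K) * ((K / (1 + K)) ^ r * t 0) := by gcongr
      _ = _ := by ring

lemma norm_sq_glue_zero_right (n : ℤ) (ψ : EllTwo) :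
    ‖glue n ψ 0‖ ^ 2 = ‖ψ n‖ ^ 2 + ‖glue (n + 1) ψ 0‖ ^ 2 := by
  rw [EllTwo.norm_sq_eq_add (n := n) (χ := glue (n + 1) ψ 0), glue_of_le le_rfl]
  · intro m hm
    rcases lt_or_gt_of_ne hm with h | h
    · rw [glue_of_lt h, glue_of_lt (by omega)]
    · rw [glue_of_le (by omega), glue_of_le (by omega)]
  · rw [glue_of_lt (by omega)]
    simp

lemma norm_sq_glue_zero_left (n : ℤ) (χ : EllTwo) :
    ‖glue (n + 1) 0 χ‖ ^ 2 = ‖χ n‖ ^ 2 + ‖glue n 0 χ‖ ^ 2 := by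
  rw [EllTwo.norm_sq_eq_add (n := n) (χ := glue n 0 χ), glue_of_lt (by omega)]
  · intro m hm
    rcases lt_or_gt_of_ne hm with h | h
    · rw [glue_of_lt (by omega), glue_of_lt (by omega)]
    · rw [glue_of_le (by omega), glue_of_le (by omega)]
  · rw [glue_of_le le_rfl]
    simp

lemma stableSol_mono {i j : ℤ} (h : i ≤ j) : stableSol a b E i ≤ stableSol a b E j :=
  fun _ hψ n hn => hψ n (h.trans hn)

lemma unstableSol_anti {i j : ℤ} (h : i ≤ j) : unstableSol a b E j ≤ unstableSol a b E i :=
  fun _ hψ n hn => hψ n (hn.trans_le h)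

/-- Gluing with zero bounds the squared tail from n by K times the squared pair at n, and this pair
is the difference of the tails from n-1 and n+1. The tails start at `j - 1` because the pair at `j`
does. -/
lemma stableSol_decay {M δ : ℝ} (hδ : 0 < δ) (ha : ‖a‖ ≤ M)
    (hT : ∀ ψ, δ * ‖ψ‖ ≤ ‖jacobiSub a b E ψ‖) {j : ℤ} {ψ : EllTwo}
    (hψ : ψ ∈ stableSol a b E j) (r : ℕ) :
    ‖pairAt (j + (2 * r : ℕ)) ψ‖ ^ 2 ≤
      ((M / δ) ^ 2 / (1 + (M / δ) ^ 2)) ^ r * ((1 + (M / δ) ^ 2) * ‖pairAt j ψ‖ ^ 2) := by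
  set K := (M / δ) ^ 2 with hK
  have hK0 : 0 ≤ K := by positivity
  have tail : ∀ n, j ≤ n → ‖glue n ψ 0‖ ^ 2 ≤ K * ‖pairAt n ψ‖ ^ 2 := fun n hn => by
    simpa using norm_sq_glue_le hδ ha hT (stableSol_mono hn hψ) (zero_mem _)
  have hpair : ∀ n, ‖pairAt n ψ‖ ^ 2 = ‖glue (n - 1) ψ 0‖ ^ 2 - ‖glue (n + 1) ψ 0‖ ^ 2 := by
    intro n
    have h1 := norm_sq_glue_zero_right n ψ
    have h2 := norm_sq_glue_zero_right (n - 1) ψ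
    rw [sub_add_cancel] at h2
    rw [C2.norm_sq, pairAt_zero, pairAt_one]
    linarith
  have main := pow_mul_of_tail_recursion hK0 (t := fun k : ℕ => ‖glue (j - 1 + k) ψ 0‖ ^ 2)
    (antitone_nat_of_succ_le fun k => by
      have := norm_sq_glue_zero_right (j - 1 + k) ψ
      push_cast
      rw [← add_assoc]
      nlinarith [sq_nonneg ‖ψ (j - 1 + k)‖])
    (fun k => by
      have h1 := tail (j + k) (by omega)
      rw [hpair] at h1
      convert h1 using 3 <;> push_cast <;> ring_nf) r
  refine le_trans ?_ (main.trans ?_)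
  · have h1 := hpair (j + (2 * r : ℕ))
    rw [h1, show j + ((2 * r : ℕ) : ℤ) - 1 = j - 1 + (2 * r : ℕ) by ring]
    nlinarith [sq_nonneg ‖glue (j + ((2 * r : ℕ) : ℤ) + 1) ψ 0‖]
  · gcongr
    have h1 := tail j le_rfl
    have h2 := norm_sq_glue_zero_right (j - 1) ψ
    have h3 := C2.norm_sq (pairAt j ψ)
    rw [pairAt_zero, pairAt_one] at h3
    rw [sub_add_cancel] at h2
    simp only [Nat.cast_zero, add_zero]
    nlinarith [sq_nonneg ‖ψ j‖]

lemma unstableSol_decay {M δ : ℝ} (hδ : 0 < δ) (ha : ‖a‖ ≤ M)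
    (hT : ∀ ψ, δ * ‖ψ‖ ≤ ‖jacobiSub a b E ψ‖) {j : ℤ} {ψ : EllTwo} (r : ℕ)
    (hψ : ψ ∈ unstableSol a b E (j + (2 * r : ℕ))) :
    ‖pairAt j ψ‖ ^ 2 ≤ ((M / δ) ^ 2 / (1 + (M / δ) ^ 2)) ^ r *
      ((1 + (M / δ) ^ 2) * ‖pairAt (j + (2 * r : ℕ)) ψ‖ ^ 2) := by
  set K := (M / δ) ^ 2 with hK
  set l := j + ((2 * r : ℕ) : ℤ) with hl
  have hK0 : 0 ≤ K := by positivity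
  have tail : ∀ n, n ≤ l → ‖glue n 0 ψ‖ ^ 2 ≤ K * ‖pairAt n ψ‖ ^ 2 := fun n hn => by
    simpa using norm_sq_glue_le hδ ha hT (zero_mem _) (unstableSol_anti hn hψ)
  have hpair : ∀ n, ‖pairAt n ψ‖ ^ 2 = ‖glue (n + 1) 0 ψ‖ ^ 2 - ‖glue (n - 1) 0 ψ‖ ^ 2 := by
    intro n
    have h1 := norm_sq_glue_zero_left n ψ
    have h2 := norm_sq_glue_zero_left (n - 1) ψ
    rw [sub_add_cancel] at h2
    rw [C2.norm_sq, pairAt_zero, pairAt_one]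
    linarith
  have main := pow_mul_of_tail_recursion hK0 (t := fun k : ℕ => ‖glue (l + 1 - k) 0 ψ‖ ^ 2)
    (antitone_nat_of_succ_le fun k => by
      have := norm_sq_glue_zero_left (l + 1 - (k + 1)) ψ
      push_cast
      rw [show l + 1 - ((k : ℤ) + 1) + 1 = l + 1 - k by ring] at this
      nlinarith [sq_nonneg ‖ψ (l + 1 - (k + 1))‖])
    (fun k => by
      have h1 := tail (l - k) (by omega)
      rw [hpair] at h1
      convert h1 using 3 <;> push_cast <;> ring_nf) r
  refine le_trans ?_ (main.trans ?_)
  · have h1 := hpair j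
    rw [h1, hl, add_right_comm, add_sub_cancel_right]
    nlinarith [sq_nonneg ‖glue (j - 1) 0 ψ‖]
  · gcongr
    have h1 := tail l le_rfl
    have h2 := norm_sq_glue_zero_left l ψ
    have h3 := C2.norm_sq (pairAt l ψ)
    rw [pairAt_zero, pairAt_one] at h3
    simp only [Nat.cast_zero, sub_zero]
    nlinarith [sq_nonneg ‖ψ (l - 1)‖]

end

/-! ### The cocycle acting on half-line solutions -/

lemma toEuclideanLin_mul_apply (A B : Matrix (Fin 2) (Fin 2) ℂ) (v : C2) :
    Matrix.toEuclideanLin (A * B) v = Matrix.toEuclideanLin A (Matrix.toEuclideanLin B v) := by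
  simp [Matrix.toLpLin_apply]

lemma toEuclideanLin_cocycleIter_zero (B : ℤ → Matrix (Fin 2) (Fin 2) ℂ) (j : ℤ) (v : C2) :
    Matrix.toEuclideanLin (cocycleIter B 0 j) v = v := by
  simp [cocycleIter]

lemma toEuclideanLin_cocycleIter_succ (B : ℤ → Matrix (Fin 2) (Fin 2) ℂ) (n : ℕ) (j : ℤ) (v : C2) :
    Matrix.toEuclideanLin (cocycleIter B (n + 1) j) v =
      Matrix.toEuclideanLin (B (j + n)) (Matrix.toEuclideanLin (cocycleIter B n j) v) :=
  toEuclideanLin_mul_apply _ _ _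

section

variable (a : lp (fun _ : ℤ => ℂ) ∞) (b : lp (fun _ : ℤ => ℝ) ∞) (E : ℂ)

lemma jacobiCocycle_apply_zero (j : ℤ) (v : C2) :
    Matrix.toEuclideanLin (jacobiCocycle a b E j) v 0 =
      (E - (b j : ℂ)) * v 0 - conj (a (j - 1)) * v 1 := by
  simp [Matrix.toLpLin_apply, jacobiCocycle, dotProduct, Fin.sum_univ_two,
    sub_eq_add_neg]

lemma jacobiCocycle_apply_one (j : ℤ) (v : C2) :
    Matrix.toEuclideanLin (jacobiCocycle a b E j) v 1 = a j * v 0 := by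
  simp [Matrix.toLpLin_apply, jacobiCocycle, dotProduct, Fin.sum_univ_two]

variable {a b E}

lemma jacobiCocycle_pairAt {j : ℤ} {ψ : EllTwo} (h : jacobiSub a b E ψ j = 0) :
    Matrix.toEuclideanLin (jacobiCocycle a b E j) (pairAt j ψ) = a j • pairAt (j + 1) ψ := by
  rw [jacobiSub_apply] at h
  ext i
  fin_cases i
  · simp only [Fin.zero_eta, jacobiCocycle_apply_zero, PiLp.smul_apply, pairAt_zero, pairAt_one,
      smul_eq_mul]
    linear_combination -h
  · simp [jacobiCocycle_apply_one]

lemma cocycleIter_pairAt_stable {j : ℤ} {ψ : EllTwo} (h : ψ ∈ stableSol a b E j) (n : ℕ) :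
    Matrix.toEuclideanLin (cocycleIter (jacobiCocycle a b E) n j) (pairAt j ψ) =
      (∏ i ∈ Finset.range n, a (j + i)) • pairAt (j + n) ψ := by
  induction n with
  | zero => simp [toEuclideanLin_cocycleIter_zero]
  | succ n ih =>
    rw [toEuclideanLin_cocycleIter_succ, ih, map_smul, jacobiCocycle_pairAt (h _ (by omega)),
      smul_smul, Finset.prod_range_succ]
    push_cast
    rw [add_assoc]

/-- Continuing ψ itself past `j` would mean dividing by `a j`. Multiplying the past by `a j` instead
leaves the new value at `j + 1` free to be read off from the cocycle; the equation at `j` then holds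
with a common factor `a j`, also when this is zero. -/
lemma jacobiCocycle_pairAt_unstable {j : ℤ} {ψ : EllTwo} (h : ψ ∈ unstableSol a b E j) :
    ∃ χ ∈ unstableSol a b E (j + 1),
      Matrix.toEuclideanLin (jacobiCocycle a b E j) (pairAt j ψ) = pairAt (j + 1) χ ∧
      ∀ n ≤ j, χ n = a j * ψ n := by
  set z : ℂ := (E - (b j : ℂ)) * ψ j - conj (a (j - 1)) * ψ (j - 1) with hz
  set χ : EllTwo := glue (j + 1) (lp.single 2 (j + 1) z) (a j • ψ) with hχ
  have h1 : ∀ n ≤ j, χ n = a j * ψ n := fun n hn => by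
    rw [hχ, glue_of_lt (by omega)]
    simp
  have h2 : χ (j + 1) = z := by
    rw [hχ, glue_of_le le_rfl]
    simp
  refine ⟨χ, fun n hn => ?_, ?_, h1⟩
  · rw [jacobiSub_apply]
    rcases (Int.lt_add_one_iff.mp hn).lt_or_eq with hlt | rfl
    · have := h n hlt
      rw [jacobiSub_apply] at this
      rw [h1 _ (by omega), h1 _ (by omega), h1 _ (by omega)]
      linear_combination a j * this
    · rw [h1 (n - 1) (by omega), h1 n le_rfl, h2, hz]
      ring
  · ext i
    fin_cases i
    · simp [jacobiCocycle_apply_zero, h2, hz]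
    · simp [jacobiCocycle_apply_one, h1]

/-- For the truncation w of ψ to (-∞, j], the vector (J - E)w lives on j and j+1, where its entries
are, up to sign, those of B(j) applied to the pair. -/
lemma norm_jacobiCocycle_pairAt_unstable {δ : ℝ} (hδ : 0 < δ)
    (hT : ∀ ψ, δ * ‖ψ‖ ≤ ‖jacobiSub a b E ψ‖) {j : ℤ} {ψ : EllTwo}
    (h : ψ ∈ unstableSol a b E j) :
    δ * ‖pairAt j ψ‖ ≤ ‖Matrix.toEuclideanLin (jacobiCocycle a b E j) (pairAt j ψ)‖ := by
  set w := glue (j + 1) 0 ψ with hw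
  have hlow : ∀ n ≤ j, w n = ψ n := fun n hn => glue_of_lt (by omega) _ _
  have hup : ∀ n, j < n → w n = 0 := fun n hn => by
    rw [hw, glue_of_le (by omega)]
    simp
  have h1 : ‖pairAt j ψ‖ ≤ ‖w‖ := by
    have : pairAt j w = pairAt j ψ := by
      ext i
      fin_cases i
      · exact hlow _ le_rfl
      · exact hlow _ (by omega)
    rw [← this]
    exact le_of_sq_le_sq (norm_sq_pairAt_le j w) (norm_nonneg _)
  have h2 : ‖jacobiSub a b E w‖ ^ 2 =
      ‖Matrix.toEuclideanLin (jacobiCocycle a b E j) (pairAt j ψ)‖ ^ 2 := by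
    rw [EllTwo.norm_sq_of_support_pair (m := j) (n := j + 1) (by omega), C2.norm_sq,
      jacobiCocycle_apply_zero, jacobiCocycle_apply_one, jacobiSub_apply, jacobiSub_apply,
      hlow _ (by omega), hup (j + 1) (by omega), hup (j + 1 + 1) (by omega), hlow j le_rfl,
      hlow _ (by omega)]
    · simp only [add_sub_cancel_right, mul_zero, add_zero, pairAt_zero, pairAt_one, norm_mul,
        RCLike.norm_conj]
      rw [← norm_neg]
      congr 3
      ring
    · intro k hk hk'
      rw [jacobiSub_apply]
      rcases lt_or_ge k j with hlt | hge
      · have := h k hlt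
        rw [jacobiSub_apply] at this
        rwa [hlow _ (by omega), hlow _ (by omega), hlow _ (by omega)]
      · rw [hup _ (by omega), hup _ (by omega), hup _ (by omega)]
        simp
  have h3 : ‖jacobiSub a b E w‖ =
      ‖Matrix.toEuclideanLin (jacobiCocycle a b E j) (pairAt j ψ)‖ := by
    rwa [sq_eq_sq₀ (norm_nonneg _) (norm_nonneg _)] at h2
  rw [← h3]
  exact le_trans (by gcongr) (hT w)

lemma cocycleIter_pairAt_unstable {δ : ℝ} (hδ : 0 < δ)
    (hT : ∀ ψ, δ * ‖ψ‖ ≤ ‖jacobiSub a b E ψ‖) {j : ℤ} {ψ : EllTwo}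
    (h : ψ ∈ unstableSol a b E j) (n : ℕ) :
    ∃ χ ∈ unstableSol a b E (j + n),
      Matrix.toEuclideanLin (cocycleIter (jacobiCocycle a b E) n j) (pairAt j ψ)
        = pairAt (j + n) χ ∧
      (∀ m ≤ j, χ m = (∏ i ∈ Finset.range n, a (j + i)) * ψ m) ∧
      δ ^ n * ‖pairAt j ψ‖ ≤ ‖pairAt (j + n) χ‖ := by
  induction n with
  | zero => exact ⟨ψ, by simpa using h, by simp [toEuclideanLin_cocycleIter_zero], by simp, by simp⟩
  | succ n ih =>
    obtain ⟨χ, hχ, h1, h2, h3⟩ := ih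
    obtain ⟨χ', hχ', h1', h2'⟩ := jacobiCocycle_pairAt_unstable hχ
    have e : j + ((n + 1 : ℕ) : ℤ) = j + n + 1 := by push_cast; ring
    refine ⟨χ', by rwa [e], by rw [toEuclideanLin_cocycleIter_succ, h1, h1', e], ?_, ?_⟩
    · intro m hm
      rw [h2' m (by omega), h2 m hm, Finset.prod_range_succ]
      ring
    · have h4 := norm_jacobiCocycle_pairAt_unstable hδ hT hχ
      rw [h1', ← e] at h4
      refine le_trans ?_ h4
      rw [pow_succ']
      nlinarith

/-! ### Existence of nonzero half-line solutions -/

lemma apply_eq_conj_apply (hE : E.im = 0) {m n : ℤ} {ψ χ : EllTwo}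
    (hψ : jacobiSub a b E ψ = lp.single 2 m 1) (hχ : jacobiSub a b E χ = lp.single 2 n 1) :
    χ m = conj (ψ n) := by
  have h := jacobiSub_inner a b E ψ χ
  rw [Complex.conj_eq_iff_im.mpr hE, hψ, hχ, lp.inner_single_left, lp.inner_single_right] at h
  simpa using h

/-- Moving J - E across ⟨(J - E)ψ, ψ⟩ produces (E - conj E)‖ψ‖² as the only surviving term. -/
lemma im_eq_zero_of_apply_eq_zero {m : ℤ} {ψ : EllTwo}
    (hψ : jacobiSub a b E ψ = lp.single 2 m 1) (h0 : ψ m = 0) : E.im = 0 := by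
  have h := jacobiSub_inner a b E ψ ψ
  have e : jacobiSub a b (conj E) ψ = jacobiSub a b E ψ + (E - conj E) • ψ := by
    simp only [jacobiSub, sub_apply, smul_apply, one_apply_eq_self, sub_smul]
    abel
  rw [e, inner_add_right, inner_smul_right, hψ, lp.inner_single_left, lp.inner_single_right,
    h0] at h
  simp only [inner_zero_right, inner_zero_left, zero_add] at h
  rcases mul_eq_zero.mp h.symm with h1 | h1
  · exact Complex.conj_eq_iff_im.mp (sub_eq_zero.mp h1).symm
  · rw [inner_self_eq_zero.mp h1] at hψ
    have := congrArg (fun φ : EllTwo => φ m) hψ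
    simp at this

lemma EllTwo.linear_combination_apply (x y z : ℂ) (φ χ ω : EllTwo) (n : ℤ) :
    (x • φ + y • χ + z • ω) n = x * φ n + y * χ n + z * ω n := rfl

lemma jacobiSub_single (j : ℤ) : jacobiSub a b E (lp.single 2 j 1) =
    a (j - 1) • lp.single 2 (j - 1) 1 + ((b j : ℂ) - E) • lp.single 2 j 1
      + conj (a j) • lp.single 2 (j + 1) 1 := by
  ext n
  rw [jacobiSub_apply, EllTwo.linear_combination_apply]
  by_cases h1 : n = j - 1
  · subst h1
    simp [show j - 1 ≠ j by omega, show j - 1 ≠ j + 1 by omega, show j - 1 - 1 ≠ j by omega]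
  by_cases h2 : n = j
  · subst h2
    simp
  by_cases h3 : n = j + 1
  · subst h3
    simp [show j + 1 ≠ j - 1 by omega, show j + 1 + 1 ≠ j by omega]
  · simp [h1, h2, h3, show n - 1 ≠ j by omega, show n + 1 ≠ j by omega]

/-- For m < j the Green column `g m` is a stable solution. If all stable pairs vanished, the
diagonal entry at j-1 would be zero, forcing E to be real; symmetry of the Green function then makes
`g j (j - 1)` vanish as well. Inverting J - E on its column at j-1 and evaluating there gives 1 = 0.
-/
lemma exists_stableSol_pairAt_ne_zero (h : IsUnit (jacobiSub a b E)) (j : ℤ) :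
    ∃ ψ ∈ stableSol a b E j, pairAt j ψ ≠ 0 := by
  by_contra! hcon
  obtain ⟨hinj, hsurj⟩ := ContinuousLinearMap.isUnit_iff_bijective.mp h
  choose g hg using fun m : ℤ => hsurj (lp.single 2 m 1)
  have hmem : ∀ m, m < j → g m ∈ stableSol a b E j := fun m hm n hn => by
    rw [hg]
    simp [show n ≠ m by omega]
  have h0 : ∀ m, m < j → g m j = 0 := fun m hm => by
    simpa using congrArg (fun v : C2 => v 0) (hcon _ (hmem m hm))
  have h1 : ∀ m, m < j → g m (j - 1) = 0 := fun m hm => by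
    simpa using congrArg (fun v : C2 => v 1) (hcon _ (hmem m hm))
  have hE : E.im = 0 := im_eq_zero_of_apply_eq_zero (hg (j - 1)) (h1 _ (by omega))
  have h2 : g j (j - 1) = 0 := by
    rw [apply_eq_conj_apply hE (hg (j - 1)) (hg j), h0 _ (by omega), map_zero]
  have h3 : lp.single 2 (j - 1) 1 = a (j - 1 - 1) • g (j - 1 - 1)
      + ((b (j - 1) : ℂ) - E) • g (j - 1) + conj (a (j - 1)) • g j := by
    apply hinj
    rw [jacobiSub_single, map_add, map_add, map_smul, map_smul, map_smul, hg, hg, hg,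
      sub_add_cancel]
  have h4 := congrArg (fun φ : EllTwo => φ (j - 1)) h3
  simp only [EllTwo.linear_combination_apply] at h4
  simp [h1 (j - 1 - 1) (by omega), h1 (j - 1) (by omega), h2] at h4

lemma exists_unstableSol_pairAt_ne_zero (h : IsUnit (jacobiSub a b E)) (j : ℤ) :
    ∃ ψ ∈ unstableSol a b E j, pairAt j ψ ≠ 0 := by
  by_contra! hcon
  obtain ⟨hinj, hsurj⟩ := ContinuousLinearMap.isUnit_iff_bijective.mp h
  choose g hg using fun m : ℤ => hsurj (lp.single 2 m 1)
  have hmem : ∀ m, j ≤ m → g m ∈ unstableSol a b E j := fun m hm n hn => by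
    rw [hg]
    simp [show n ≠ m by omega]
  have h0 : ∀ m, j ≤ m → g m j = 0 := fun m hm => by
    simpa using congrArg (fun v : C2 => v 0) (hcon _ (hmem m hm))
  have h1 : ∀ m, j ≤ m → g m (j - 1) = 0 := fun m hm => by
    simpa using congrArg (fun v : C2 => v 1) (hcon _ (hmem m hm))
  have hE : E.im = 0 := im_eq_zero_of_apply_eq_zero (hg j) (h0 _ (by omega))
  have h2 : g (j - 1) j = 0 := by
    rw [apply_eq_conj_apply hE (hg j) (hg (j - 1)), h1 _ (by omega), map_zero]
  have h3 : lp.single 2 j 1 = a (j - 1) • g (j - 1)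
      + ((b j : ℂ) - E) • g j + conj (a j) • g (j + 1) := by
    apply hinj
    rw [jacobiSub_single, map_add, map_add, map_smul, map_smul, map_smul, hg, hg, hg]
  have h4 := congrArg (fun φ : EllTwo => φ j) h3
  simp only [EllTwo.linear_combination_apply] at h4
  simp [h0 j (by omega), h0 (j + 1) (by omega), h2] at h4

/-! ### Construction of the dominated splitting -/

/-- Area equals base times height: the left side is the distance from s to the line of u. This turns
the angle estimate into chordal distance. -/
lemma norm_sub_smul_eq_norm_det {s u : C2} (hu : ‖u‖ = 1) :
    ‖s - (conj (u 0) * s 0 + conj (u 1) * s 1) • u‖ = ‖u 0 * s 1 - u 1 * s 0‖ := by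
  have h1 : (conj (u 0) * u 0 + conj (u 1) * u 1 : ℂ) = 1 := by
    rw [← Complex.normSq_eq_conj_mul_self, ← Complex.normSq_eq_conj_mul_self,
      Complex.normSq_eq_norm_sq, Complex.normSq_eq_norm_sq, ← Complex.ofReal_add, ← C2.norm_sq, hu]
    simp
  rw [← sq_eq_sq₀ (norm_nonneg _) (norm_nonneg _), C2.norm_sq]
  have e0 : (s - (conj (u 0) * s 0 + conj (u 1) * s 1) • u) 0 =
      -(conj (u 1) * (u 0 * s 1 - u 1 * s 0)) := by
    simp only [PiLp.sub_apply, PiLp.smul_apply, smul_eq_mul]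
    linear_combination (-s 0) * h1
  have e1 : (s - (conj (u 0) * s 0 + conj (u 1) * s 1) • u) 1 =
      conj (u 0) * (u 0 * s 1 - u 1 * s 0) := by
    simp only [PiLp.sub_apply, PiLp.smul_apply, smul_eq_mul]
    linear_combination (-s 1) * h1
  have h2 := C2.norm_sq u
  rw [hu] at h2
  rw [e0, e1, norm_neg, norm_mul, norm_mul, RCLike.norm_conj, RCLike.norm_conj]
  linear_combination (-‖u 0 * s 1 - u 1 * s 0‖ ^ 2) * h2

lemma finrank_eq_one_of_disjoint {S U : Submodule ℂ C2} (hd : Disjoint S U) (hS : S ≠ ⊥)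
    (hU : U ≠ ⊥) : Module.finrank ℂ S = 1 ∧ Module.finrank ℂ U = 1 := by
  have h1 := Submodule.finrank_add_finrank_le_of_disjoint hd
  have h2 : Module.finrank ℂ C2 = 2 := by simp
  have h3 := Submodule.one_le_finrank_iff.mpr hS
  have h4 := Submodule.one_le_finrank_iff.mpr hU
  omega

lemma exists_dominatedSplitting_of_isUnit {M δ : ℝ} (hδ : 0 < δ) (ha : ‖a‖ ≤ M)
    (hunit : IsUnit (jacobiSub a b E)) (hT : ∀ ψ, δ * ‖ψ‖ ≤ ‖jacobiSub a b E ψ‖) {r : ℕ}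
    (hr : ((M / δ) ^ 2 / (1 + (M / δ) ^ 2)) ^ r * (1 + (M / δ) ^ 2) < 1 / 2) :
    ∃ Eu Es : ℤ → ℙ ℂ C2, IsDominatedSplitting (jacobiCocycle a b E) Eu Es (2 * r) 2
      (1 / Real.sqrt (2 * (M / δ) ^ 2 + 2)) := by
  set K := (M / δ) ^ 2 with hK
  have hK0 : 0 ≤ K := by positivity
  set κ := (K / (1 + K)) ^ r * (1 + K) with hκ
  have hκ0 : 0 ≤ κ := by positivity
  set S : ℤ → Submodule ℂ C2 := fun j => (stableSol a b E j).map (pairAt j) with hS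
  set U : ℤ → Submodule ℂ C2 := fun j => (unstableSol a b E j).map (pairAt j) with hU
  have hsep : ∀ j, ∀ s ∈ S j, ∀ u ∈ U j, ‖s‖ ^ 2 ≤ (2 * K + 2) * ‖s - u‖ ^ 2 := by
    rintro j _ ⟨ψ, hψ, rfl⟩ _ ⟨χ, hχ, rfl⟩
    exact norm_sq_pairAt_le_sub hδ ha hT hψ hχ
  have hdisj : ∀ j, Disjoint (S j) (U j) := fun j => by
    rw [Submodule.disjoint_def]
    intro x hx hx'
    have := hsep j x hx x hx'
    simpa using this
  have hSne : ∀ j, S j ≠ ⊥ := fun j => by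
    obtain ⟨ψ, h1, h2⟩ := exists_stableSol_pairAt_ne_zero hunit j
    exact (Submodule.ne_bot_iff _).mpr ⟨_, ⟨ψ, h1, rfl⟩, h2⟩
  have hUne : ∀ j, U j ≠ ⊥ := fun j => by
    obtain ⟨ψ, h1, h2⟩ := exists_unstableSol_pairAt_ne_zero hunit j
    exact (Submodule.ne_bot_iff _).mpr ⟨_, ⟨ψ, h1, rfl⟩, h2⟩
  have hrank := fun j => finrank_eq_one_of_disjoint (hdisj j) (hSne j) (hUne j)
  have hUiter : ∀ j, ∀ u ∈ U j, ‖u‖ = 1 →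
      δ ^ (2 * r) ≤ ‖Matrix.toEuclideanLin (cocycleIter (jacobiCocycle a b E) (2 * r) j) u‖ ∧
      ‖∏ i ∈ Finset.range (2 * r), a (j + i)‖ ^ 2 ≤
        κ * ‖Matrix.toEuclideanLin (cocycleIter (jacobiCocycle a b E) (2 * r) j) u‖ ^ 2 := by
    rintro j _ ⟨ψ, hψ, rfl⟩ hu
    obtain ⟨χ, hχ, h1, h2, h3⟩ := cocycleIter_pairAt_unstable hδ hT hψ (2 * r)
    rw [hu, mul_one] at h3
    rw [h1]
    refine ⟨h3, ?_⟩
    have h4 := unstableSol_decay hδ ha hT r hχ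
    have h5 : pairAt j χ = (∏ i ∈ Finset.range (2 * r), a (j + i)) • pairAt j ψ := by
      ext i
      fin_cases i
      · simpa using h2 j le_rfl
      · simpa using h2 (j - 1) (by omega)
    rw [h5, norm_smul, hu, mul_one, ← mul_assoc] at h4
    exact h4
  have hSiter : ∀ j, ∀ s ∈ S j, ‖s‖ = 1 →
      ‖Matrix.toEuclideanLin (cocycleIter (jacobiCocycle a b E) (2 * r) j) s‖ ^ 2 ≤
        κ * ‖∏ i ∈ Finset.range (2 * r), a (j + i)‖ ^ 2 := by
    rintro j _ ⟨ψ, hψ, rfl⟩ hs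
    have h4 := stableSol_decay hδ ha hT hψ r
    rw [hs, one_pow, mul_one] at h4
    rw [cocycleIter_pairAt_stable hψ, norm_smul, mul_pow, mul_comm κ]
    gcongr
  refine ⟨fun j => .mk'' (U j) (hrank j).2, fun j => .mk'' (S j) (hrank j).1, ?_, ?_, ?_, ?_, ?_⟩
  · intro j
    simp only [Projectivization.submodule_mk'']
    rintro _ ⟨_, ⟨ψ, hψ, rfl⟩, rfl⟩
    obtain ⟨χ, hχ, h1, -⟩ := jacobiCocycle_pairAt_unstable hψ
    exact ⟨χ, hχ, h1.symm⟩
  · intro j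
    simp only [Projectivization.submodule_mk'']
    rintro _ ⟨_, ⟨ψ, hψ, rfl⟩, rfl⟩
    rw [jacobiCocycle_pairAt (hψ j le_rfl)]
    exact Submodule.smul_mem _ _ ⟨ψ, stableSol_mono (by omega) hψ, rfl⟩
  · intro j u hu s hs hu1 hs1
    rw [Projectivization.submodule_mk''] at hu hs
    obtain ⟨h1, h2⟩ := hUiter j u hu hu1
    have h3 := hSiter j s hs hs1
    set x := ‖Matrix.toEuclideanLin (cocycleIter (jacobiCocycle a b E) (2 * r) j) u‖
    set y := ‖Matrix.toEuclideanLin (cocycleIter (jacobiCocycle a b E) (2 * r) j) s‖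
    have hx : 0 < x := lt_of_lt_of_le (by positivity) h1
    -- The product of the a's cancels between the stable upper bound and the unstable lower bound.
    have h4 : y ^ 2 ≤ (κ * x) ^ 2 := by
      calc y ^ 2 ≤ κ * (κ * x ^ 2) := h3.trans (by gcongr)
        _ = _ := by ring
    have h5 : y ≤ κ * x := le_of_sq_le_sq h4 (by positivity)
    nlinarith
  · intro j
    obtain ⟨ψ, hψ, hne⟩ := exists_unstableSol_pairAt_ne_zero hunit j
    obtain ⟨χ, hχ, hne'⟩ := exists_stableSol_pairAt_ne_zero hunit j
    have hn : ‖pairAt j ψ‖ ≠ 0 := norm_ne_zero_iff.mpr hne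
    have hn' : ‖pairAt j χ‖ ≠ 0 := norm_ne_zero_iff.mpr hne'
    set u : C2 := ((‖pairAt j ψ‖⁻¹ : ℝ) : ℂ) • pairAt j ψ with hu
    set s : C2 := ((‖pairAt j χ‖⁻¹ : ℝ) : ℂ) • pairAt j χ with hs
    have hu1 : ‖u‖ = 1 := by rw [hu, norm_smul]; simp [hn]
    have hs1 : ‖s‖ = 1 := by rw [hs, norm_smul]; simp [hn']
    have huU : u ∈ U j := Submodule.smul_mem _ _ ⟨ψ, hψ, rfl⟩
    have hsS : s ∈ S j := Submodule.smul_mem _ _ ⟨χ, hχ, rfl⟩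
    rw [lineDist_eq _ _ u s (by rintro h; simp [h] at hu1) (by rintro h; simp [h] at hs1)
      (by rwa [Projectivization.submodule_mk'']) (by rwa [Projectivization.submodule_mk'']),
      chordalDist_projCP1 _ _ (by rintro h; simp [h] at hu1) (by rintro h; simp [h] at hs1),
      hu1, hs1, mul_one, div_one]
    -- The separation estimate is applied to the orthogonal projection of s to the line of u.
    have h1 := hsep j s hsS _ (Submodule.smul_mem _ (conj (u 0) * s 0 + conj (u 1) * s 1) huU)
    rw [norm_sub_smul_eq_norm_det hu1, hs1] at h1
    set d := ‖u 0 * s 1 - u 1 * s 0‖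
    have hq : 0 < Real.sqrt (2 * K + 2) := Real.sqrt_pos.mpr (by positivity)
    have h2 : 1 ≤ Real.sqrt (2 * K + 2) * d := by
      refine le_of_sq_le_sq ?_ (by positivity)
      rw [mul_pow, Real.sq_sqrt (by positivity)]
      exact h1
    rw [div_lt_iff₀ hq]
    linarith
  · refine ⟨δ ^ (2 * r), by positivity, fun j => ?_⟩
    obtain ⟨ψ, hψ, hne⟩ := exists_unstableSol_pairAt_ne_zero hunit j
    have hn : ‖pairAt j ψ‖ ≠ 0 := norm_ne_zero_iff.mpr hne
    set u : C2 := ((‖pairAt j ψ‖⁻¹ : ℝ) : ℂ) • pairAt j ψ with hu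
    have hu1 : ‖u‖ = 1 := by rw [hu, norm_smul]; simp [hn]
    have huU : u ∈ U j := Submodule.smul_mem _ _ ⟨ψ, hψ, rfl⟩
    refine (hUiter j u huU hu1).1.trans ?_
    have := ContinuousLinearMap.le_opNorm (Matrix.toEuclideanCLM (n := Fin 2) (𝕜 := ℂ)
      (cocycleIter (jacobiCocycle a b E) (2 * r) j)) u
    rw [hu1, mul_one] at this
    exact this

end

theorem exists_uniform_dominatedSplitting (M δ : ℝ) (hδ : 0 < δ) :
    ∃ (N : ℕ) (η : ℝ), 0 < N ∧ 0 < η ∧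
      ∀ (a : lp (fun _ : ℤ => ℂ) ∞) (b : lp (fun _ : ℤ => ℝ) ∞) (E : ℂ),
        ‖a‖ ≤ M → δ ≤ Metric.infDist E (spectrum ℂ (jacobiOp a b)) →
        ∃ Eu Es : ℤ → ℙ ℂ C2, IsDominatedSplitting (jacobiCocycle a b E) Eu Es N 2 η := by
  set K := (M / δ) ^ 2 with hK
  have hK0 : 0 ≤ K := by positivity
  -- This choice makes κ = (K/(1+K))^r (1+K) less than 1/2, which gives the domination factor 2 over
  -- 2r steps.
  obtain ⟨r, hr⟩ := exists_pow_lt_of_lt_one (x := 1 / 2 / (1 + K)) (y := K / (1 + K))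
    (by positivity) ((div_lt_one (by positivity)).mpr (by linarith))
  rw [lt_div_iff₀ (by positivity)] at hr
  have hr0 : r ≠ 0 := by
    rintro rfl
    norm_num at hr
    linarith
  refine ⟨2 * r, 1 / Real.sqrt (2 * K + 2), by omega,
    one_div_pos.mpr (Real.sqrt_pos.mpr (by positivity)), fun a b E ha h => ?_⟩
  exact exists_dominatedSplitting_of_isUnit hδ ha
    (isUnit_of_infDist_spectrum_pos a b E (hδ.trans_le h))
    (norm_le_of_le_infDist_spectrum a b E hδ h) hr

/-! ### Weighted shifts with decaying products of weights -/

lemma weightedShift_norm_le_opNorm (c : ℤ → ℂ) (C : ℝ) (hc : ∀ n, ‖c n‖ ≤ C) (k : ℤ)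
    (ψ : EllTwo) : ‖weightedShift c C hc k ψ‖ ≤ C * ‖ψ‖ :=
  weightedShift_norm_le c C hc k ψ

lemma weightedShift_pow_apply (c : ℤ → ℂ) (C : ℝ) (hc : ∀ n, ‖c n‖ ≤ C) (k : ℤ) (L : ℕ)
    (ψ : EllTwo) (n : ℤ) : (weightedShift c C hc k ^ L) ψ n =
      (∏ i ∈ Finset.range L, c (n + i * k)) * ψ (n + L * k) := by
  induction L generalizing ψ with
  | zero => simp
  | succ L ih =>
    rw [pow_succ, mul_apply_eq_comp, ih, weightedShift_apply, Finset.prod_range_succ, mul_assoc,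
      show n + ((L + 1 : ℕ) : ℤ) * k = n + L * k + k by push_cast; ring]

/-- If the products of `L` consecutive weights are at most `1/2`, then `1 - W` is bounded below. -/
lemma weightedShift_sub_bounded_below (c : ℤ → ℂ) (C : ℝ) (hc : ∀ n, ‖c n‖ ≤ C) (k : ℤ) (L : ℕ)
    (h : ∀ n : ℤ, ∏ i ∈ Finset.range L, ‖c (n + i * k)‖ ≤ 1 / 2) :
    ∃ K : ℝ, 0 ≤ K ∧ ∀ φ : EllTwo, ‖φ‖ ≤ K * ‖φ - weightedShift c C hc k φ‖ := by
  set W := weightedShift c C hc k with hW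
  refine ⟨2 * ‖∑ i ∈ Finset.range L, W ^ i‖, by positivity, fun φ => ?_⟩
  -- Truncated Neumann series; the remainder W^L φ is absorbed since ‖W^L‖ ≤ 1/2.
  have h1 : φ = (∑ i ∈ Finset.range L, W ^ i) (φ - W φ) + (W ^ L) φ := by
    have := congrArg (fun T : EllTwo →L[ℂ] EllTwo => T φ) (geom_sum_mul_neg W L)
    simp only [mul_apply_eq_comp, sub_apply, one_apply_eq_self] at this
    rw [this]
    abel
  have h2 : ‖(W ^ L) φ‖ ≤ 1 / 2 * ‖φ‖ := by
    have e : (W ^ L) φ = weightedShift (fun n => ∏ i ∈ Finset.range L, c (n + i * k)) (1 / 2)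
        (fun n => by rw [norm_prod]; exact h n) (L * k) φ := by
      ext n
      rw [weightedShift_pow_apply, weightedShift_apply]
    rw [e]
    exact weightedShift_norm_le_opNorm _ _ _ _ _
  have h3 := ContinuousLinearMap.le_opNorm (∑ i ∈ Finset.range L, W ^ i) (φ - W φ)
  have h4 : ‖φ‖ ≤ ‖(∑ i ∈ Finset.range L, W ^ i) (φ - W φ)‖ + ‖(W ^ L) φ‖ := by
    conv_lhs => rw [h1]
    exact norm_add_le _ _
  linarith

lemma prod_range_mul_le_pow {ρ : ℤ → ℝ} (hρ : ∀ n, 0 ≤ ρ n) {N : ℕ} {θ : ℝ}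
    (h : ∀ n : ℤ, ∏ i ∈ Finset.range N, ρ (n + i) ≤ θ) (r : ℕ) (n : ℤ) :
    ∏ i ∈ Finset.range (N * r), ρ (n + i) ≤ θ ^ r := by
  have hθ : 0 ≤ θ := (Finset.prod_nonneg fun i _ => hρ _).trans (h 0)
  induction r with
  | zero => simp
  | succ r ih =>
    rw [Nat.mul_succ, Finset.prod_range_add, pow_succ]
    refine mul_le_mul ih ?_ (Finset.prod_nonneg fun i _ => hρ _) (by positivity)
    have := h (n + (N * r : ℕ))
    simpa only [Nat.cast_add, add_assoc] using this

/-- The relation `hxy` telescopes: an L-fold product X of x and the product Y of y over the window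
shifted by one agree up to the factor κ = M/m. Hence X² ≤ κXY and Y² ≤ κXY, while XY is small by
hypothesis. -/
lemma exists_prod_le_half {x y w : ℤ → ℝ} {C m M θ : ℝ} {N : ℕ} (hx : ∀ n, 0 ≤ x n)
    (hy : ∀ n, 0 ≤ y n) (hxC : ∀ n, x n ≤ C) (hyC : ∀ n, y n ≤ C) (hm : 0 < m)
    (hwm : ∀ n, m ≤ w n) (hwM : ∀ n, w n ≤ M) (hxy : ∀ n, x n * w (n + 1) = y (n + 1) * w n)
    (hθ : θ < 1) (h : ∀ n : ℤ, ∏ i ∈ Finset.range N, (x (n + i) * y (n + i)) ≤ θ) :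
    ∃ L : ℕ, ∀ n : ℤ, ∏ i ∈ Finset.range L, x (n + i) ≤ 1 / 2 ∧
      ∏ i ∈ Finset.range L, y (n + i) ≤ 1 / 2 := by
  have hθ0 : 0 ≤ θ := (Finset.prod_nonneg fun i _ => mul_nonneg (hx _) (hy _)).trans (h 0)
  have hC : 0 ≤ C := (hx 0).trans (hxC 0)
  have hM : 0 < M := hm.trans_le ((hwm 0).trans (hwM 0))
  set κ := M / m with hκ
  have hκ1 : 1 ≤ κ := (one_le_div hm).mpr ((hwm 0).trans (hwM 0))
  have hw0 : ∀ n, 0 < w n := fun n => hm.trans_le (hwm n)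
  have htel : ∀ (L : ℕ) (n : ℤ), (∏ i ∈ Finset.range L, x (n + i)) * w (n + L) =
      (∏ i ∈ Finset.range L, y (n + 1 + i)) * w n := by
    intro L n
    induction L with
    | zero => simp
    | succ L ih =>
      have h1 := hxy (n + L)
      rw [Finset.prod_range_succ, Finset.prod_range_succ]
      push_cast
      rw [← add_assoc, add_right_comm n 1 (L : ℤ)]
      calc (∏ i ∈ Finset.range L, x (n + i)) * x (n + L) * w (n + L + 1)
          = ((∏ i ∈ Finset.range L, x (n + i)) * w (n + L)) * y (n + L + 1) := by
            linear_combination (∏ i ∈ Finset.range L, x (n + i)) * h1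
        _ = _ := by rw [ih]; ring
  have hX0 : ∀ (L : ℕ) (n : ℤ), 0 ≤ ∏ i ∈ Finset.range L, x (n + i) :=
    fun L n => Finset.prod_nonneg fun i _ => hx _
  have hY0 : ∀ (L : ℕ) (n : ℤ), 0 ≤ ∏ i ∈ Finset.range L, y (n + i) :=
    fun L n => Finset.prod_nonneg fun i _ => hy _
  have hXY : ∀ (L : ℕ) (n : ℤ), ∏ i ∈ Finset.range L, x (n + i) ≤
      κ * ∏ i ∈ Finset.range L, y (n + 1 + i) := by
    intro L n
    rw [hκ, div_mul_eq_mul_div, le_div_iff₀ hm]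
    calc _ ≤ (∏ i ∈ Finset.range L, x (n + i)) * w (n + L) :=
          mul_le_mul_of_nonneg_left (hwm _) (hX0 _ _)
      _ = _ := htel L n
      _ ≤ (∏ i ∈ Finset.range L, y (n + 1 + i)) * M :=
          mul_le_mul_of_nonneg_left (hwM _) (hY0 _ _)
      _ = _ := mul_comm _ _
  have hYX : ∀ (L : ℕ) (n : ℤ), ∏ i ∈ Finset.range L, y (n + 1 + i) ≤
      κ * ∏ i ∈ Finset.range L, x (n + i) := by
    intro L n
    rw [hκ, div_mul_eq_mul_div, le_div_iff₀ hm]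
    calc _ ≤ (∏ i ∈ Finset.range L, y (n + 1 + i)) * w n :=
          mul_le_mul_of_nonneg_left (hwm _) (hY0 _ _)
      _ = _ := (htel L n).symm
      _ ≤ (∏ i ∈ Finset.range L, x (n + i)) * M :=
          mul_le_mul_of_nonneg_left (hwM _) (hX0 _ _)
      _ = _ := mul_comm _ _
  -- The two windows of length Nr + 1 overlap in Nr sites, where the hypothesis applies r times; the
  -- two leftover end factors cost C².
  have hXYr : ∀ (r : ℕ) (n : ℤ), (∏ i ∈ Finset.range (N * r + 1), x (n + i)) *
      ∏ i ∈ Finset.range (N * r + 1), y (n + 1 + i) ≤ C ^ 2 * θ ^ r := by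
    intro r n
    have h1 := prod_range_mul_le_pow (fun n => mul_nonneg (hx n) (hy n)) h r (n + 1)
    rw [Finset.prod_mul_distrib] at h1
    rw [Finset.prod_range_succ', Finset.prod_range_succ]
    have e : ∏ i ∈ Finset.range (N * r), x (n + (i + 1 : ℕ)) =
        ∏ i ∈ Finset.range (N * r), x (n + 1 + i) :=
      Finset.prod_congr rfl fun i _ => by push_cast; ring_nf
    rw [e]
    calc _ = (x (n + (0 : ℕ)) * y (n + 1 + (N * r : ℕ))) *
          ((∏ i ∈ Finset.range (N * r), x (n + 1 + i)) *
            ∏ i ∈ Finset.range (N * r), y (n + 1 + i)) := by ring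
      _ ≤ (C * C) * θ ^ r :=
        mul_le_mul (mul_le_mul (hxC _) (hyC _) (hy _) hC) h1
          (mul_nonneg (hX0 _ _) (hY0 _ _)) (by positivity)
      _ = _ := by ring
  obtain ⟨r, hr⟩ := exists_pow_lt_of_lt_one (x := 1 / 4 / (κ * C ^ 2 + 1)) (y := θ)
    (by positivity) hθ
  rw [lt_div_iff₀ (by positivity)] at hr
  have hr' : κ * (C ^ 2 * θ ^ r) ≤ 1 / 4 := by nlinarith [pow_nonneg hθ0 r]
  refine ⟨N * r + 1, fun n => ⟨?_, ?_⟩⟩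
  · have h1 := hXY (N * r + 1) n
    have h2 := hXYr r n
    have h3 := hX0 (N * r + 1) n
    set X := ∏ i ∈ Finset.range (N * r + 1), x (n + i)
    set Y := ∏ i ∈ Finset.range (N * r + 1), y (n + 1 + i)
    have h4 : X * X ≤ X * (κ * Y) := mul_le_mul_of_nonneg_left h1 h3
    have h5 : κ * (X * Y) ≤ κ * (C ^ 2 * θ ^ r) := mul_le_mul_of_nonneg_left h2 (by positivity)
    nlinarith
  · have h1 := hYX (N * r + 1) (n - 1)
    have h2 := hXYr r (n - 1)
    have h3 := hY0 (N * r + 1) (n - 1 + 1)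
    rw [← sub_add_cancel n 1]
    set X := ∏ i ∈ Finset.range (N * r + 1), x (n - 1 + i)
    set Y := ∏ i ∈ Finset.range (N * r + 1), y (n - 1 + 1 + i)
    have h4 : Y * Y ≤ Y * (κ * X) := mul_le_mul_of_nonneg_left h1 h3
    have h5 : κ * (X * Y) ≤ κ * (C ^ 2 * θ ^ r) := mul_le_mul_of_nonneg_left h2 (by positivity)
    nlinarith

/-! ### Unit frames of a dominated splitting -/

lemma exists_unit_generator (V : ℙ ℂ C2) :
    ∃ v ∈ V.submodule, ‖v‖ = 1 ∧ ∀ x ∈ V.submodule, ∃ c : ℂ, x = c • v := by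
  have hn : ‖V.rep‖ ≠ 0 := norm_ne_zero_iff.mpr V.rep_nonzero
  have hc : ((‖V.rep‖⁻¹ : ℝ) : ℂ) ≠ 0 := by simpa using V.rep_nonzero
  have hV : V.submodule = Submodule.span ℂ {V.rep} := V.submodule_eq
  refine ⟨((‖V.rep‖⁻¹ : ℝ) : ℂ) • V.rep, ?_, ?_, ?_⟩
  · rw [hV]
    exact Submodule.smul_mem _ _ (Submodule.mem_span_singleton_self _)
  · rw [norm_smul]
    simp [hn]
  · intro x hx
    rw [hV, Submodule.mem_span_singleton] at hx
    obtain ⟨c, rfl⟩ := hx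
    exact ⟨c * ((‖V.rep‖⁻¹ : ℝ) : ℂ)⁻¹, by rw [smul_smul, inv_mul_cancel_right₀ hc]⟩

/-- The determinant of the matrix with columns `v`, `w`. -/
noncomputable def C2.wedge (v w : C2) : ℂ := v 0 * w 1 - v 1 * w 0

lemma C2.norm_apply_le (v : C2) (i : Fin 2) : ‖v i‖ ≤ ‖v‖ := PiLp.norm_apply_le v i

lemma C2.norm_wedge_le (v w : C2) : ‖C2.wedge v w‖ ≤ 2 * (‖v‖ * ‖w‖) := by
  have h1 : ‖v 0 * w 1‖ ≤ ‖v‖ * ‖w‖ := by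
    rw [norm_mul]
    gcongr <;> exact C2.norm_apply_le _ _
  have h2 : ‖v 1 * w 0‖ ≤ ‖v‖ * ‖w‖ := by
    rw [norm_mul]
    gcongr <;> exact C2.norm_apply_le _ _
  have := norm_sub_le (v 0 * w 1) (v 1 * w 0)
  rw [C2.wedge]
  linarith

lemma C2.wedge_smul_eq (x u s : C2) :
    C2.wedge u s • x = C2.wedge x s • u + C2.wedge u x • s := by
  ext i
  fin_cases i <;> simp [C2.wedge] <;> ring

lemma toEuclideanLin_cocycleIter_eigen {B : ℤ → Matrix (Fin 2) (Fin 2) ℂ} {v : ℤ → C2} {α : ℤ → ℂ}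
    (h : ∀ n, Matrix.toEuclideanLin (B n) (v n) = α n • v (n + 1)) (N : ℕ) (j : ℤ) :
    Matrix.toEuclideanLin (cocycleIter B N j) (v j) =
      (∏ i ∈ Finset.range N, α (j + i)) • v (j + N) := by
  induction N with
  | zero => simp [toEuclideanLin_cocycleIter_zero]
  | succ N ih =>
    rw [toEuclideanLin_cocycleIter_succ, ih, map_smul, h, smul_smul, Finset.prod_range_succ]
    push_cast
    rw [add_assoc]

/-- A dominated splitting in terms of unit vectors spanning the two families of lines. -/
lemma AdmitsDominatedSplitting.exists_frame {B : ℤ → Matrix (Fin 2) (Fin 2) ℂ}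
    (h : AdmitsDominatedSplitting B) :
    ∃ (u s : ℤ → C2) (α β : ℤ → ℂ) (N : ℕ) (θ c C η : ℝ),
      (∀ n, ‖u n‖ = 1) ∧ (∀ n, ‖s n‖ = 1) ∧
      (∀ n, Matrix.toEuclideanLin (B n) (u n) = α n • u (n + 1)) ∧
      (∀ n, Matrix.toEuclideanLin (B n) (s n) = β n • s (n + 1)) ∧
      0 < c ∧ (∀ n, c ≤ ‖α n‖) ∧ (∀ n, ‖α n‖ ≤ C) ∧ 0 < η ∧ (∀ n, η ≤ ‖C2.wedge (u n) (s n)‖) ∧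
      θ < 1 ∧ ∀ n : ℤ, ∏ i ∈ Finset.range N, (‖β (n + i)‖ / ‖α (n + i)‖) ≤ θ := by
  obtain ⟨⟨C, hC⟩, Eu, Es, N, lam, δ, hN, hlam, hδ, hDS⟩ := h
  choose u huE hu1 hu using fun n => exists_unit_generator (Eu n)
  choose s hsE hs1 hs using fun n => exists_unit_generator (Es n)
  have hBu : ∀ n, ∃ c : ℂ, Matrix.toEuclideanLin (B n) (u n) = c • u (n + 1) := fun n =>
    hu _ _ (hDS.invariant_u n ⟨u n, huE n, rfl⟩)
  have hBs : ∀ n, ∃ c : ℂ, Matrix.toEuclideanLin (B n) (s n) = c • s (n + 1) := fun n =>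
    hs _ _ (hDS.invariant_s n ⟨s n, hsE n, rfl⟩)
  choose α hα using hBu
  choose β hβ using hBs
  have hne : ∀ v : C2, ‖v‖ = 1 → v ≠ 0 := fun v hv h0 => by simp [h0] at hv
  have hsep : ∀ n, δ / 2 ≤ ‖C2.wedge (u n) (s n)‖ := fun n => by
    have h1 := hDS.separation n
    rw [lineDist_eq _ _ (u n) (s n) (hne _ (hu1 n)) (hne _ (hs1 n)) (huE n) (hsE n),
      chordalDist_projCP1 _ _ (hne _ (hu1 n)) (hne _ (hs1 n)), hu1, hs1, mul_one, div_one] at h1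
    rw [C2.wedge]
    linarith
  have hαC : ∀ n, ‖α n‖ ≤ max C 1 := fun n => by
    have h1 := ContinuousLinearMap.le_of_opNorm_le _ (hC n) (u n)
    have h2 : ‖Matrix.toEuclideanLin (B n) (u n)‖ ≤ C * ‖u n‖ := h1
    rw [hα, norm_smul, hu1, hu1, mul_one, mul_one] at h2
    exact h2.trans (le_max_left _ _)
  have hnu : ∀ n, ‖Matrix.toEuclideanLin (cocycleIter B N n) (u n)‖ =
      ∏ i ∈ Finset.range N, ‖α (n + i)‖ := fun n => by
    rw [toEuclideanLin_cocycleIter_eigen hα, norm_smul, hu1, mul_one, norm_prod]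
  have hns : ∀ n, ‖Matrix.toEuclideanLin (cocycleIter B N n) (s n)‖ =
      ∏ i ∈ Finset.range N, ‖β (n + i)‖ := fun n => by
    rw [toEuclideanLin_cocycleIter_eigen hβ, norm_smul, hs1, mul_one, norm_prod]
  have hdom : ∀ n, lam * ∏ i ∈ Finset.range N, ‖β (n + i)‖ < ∏ i ∈ Finset.range N, ‖α (n + i)‖ :=
    fun n => by
      have := hDS.domination n (u n) (huE n) (s n) (hsE n) (hu1 n) (hs1 n)
      rwa [hnu, hns] at this
  have hβ0 : ∀ n : ℤ, 0 ≤ ∏ i ∈ Finset.range N, ‖β (n + i)‖ :=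
    fun n => Finset.prod_nonneg fun i _ => norm_nonneg _
  have hα0 : ∀ n : ℤ, 0 < ∏ i ∈ Finset.range N, ‖α (n + i)‖ := fun n =>
    (mul_nonneg (by linarith) (hβ0 n)).trans_lt (hdom n)
  obtain ⟨m, hm, hmB⟩ := hDS.norm_lower
  -- B_N is bounded by its values on the frame: both are at most A, the two coordinates cost 2‖x‖
  -- each and the determinant is at least δ/2, so ‖B_N‖ ≤ (8/δ) A.
  have hlow : ∀ n : ℤ, m * δ / 8 ≤ ∏ i ∈ Finset.range N, ‖α (n + i)‖ := fun n => by
    set A := ∏ i ∈ Finset.range N, ‖α (n + i)‖ with hA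
    have hsA : ‖Matrix.toEuclideanLin (cocycleIter B N n) (s n)‖ ≤ A := by
      rw [hns]
      nlinarith [hdom n, hβ0 n]
    have h1 : ‖Matrix.toEuclideanCLM (n := Fin 2) (𝕜 := ℂ) (cocycleIter B N n)‖ ≤ 8 / δ * A := by
      refine ContinuousLinearMap.opNorm_le_bound _ (by have := hα0 n; positivity) fun x => ?_
      change ‖Matrix.toEuclideanLin (cocycleIter B N n) x‖ ≤ _
      have h2 := congrArg (fun v => ‖Matrix.toEuclideanLin (cocycleIter B N n) v‖)
        (C2.wedge_smul_eq x (u n) (s n))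
      simp only [map_smul, map_add, norm_smul] at h2
      have h3 : ‖C2.wedge x (s n)‖ ≤ 2 * ‖x‖ := by simpa [hs1] using C2.norm_wedge_le x (s n)
      have h4 : ‖C2.wedge (u n) x‖ ≤ 2 * ‖x‖ := by simpa [hu1] using C2.norm_wedge_le (u n) x
      have h5 : δ / 2 * ‖Matrix.toEuclideanLin (cocycleIter B N n) x‖ ≤
          2 * ‖x‖ * A + 2 * ‖x‖ * A :=
        calc _ ≤ ‖C2.wedge (u n) (s n)‖ * ‖Matrix.toEuclideanLin (cocycleIter B N n) x‖ := by
              gcongr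
              exact hsep n
          _ = _ := h2
          _ ≤ _ := norm_add_le _ _
          _ ≤ _ := by
              rw [norm_smul, norm_smul, hnu]
              gcongr
      rw [div_mul_eq_mul_div, div_mul_eq_mul_div, le_div_iff₀ hδ]
      linarith
    have h2 := (hmB n).trans h1
    rw [div_mul_eq_mul_div, le_div_iff₀ hδ] at h2
    linarith
  have hC1 : (1 : ℝ) ≤ max C 1 := le_max_right _ _
  refine ⟨u, s, α, β, N, 1 / lam, m * δ / 8 / max C 1 ^ (N - 1), max C 1, δ / 2, hu1, hs1, hα, hβ,
    by positivity, fun n => ?_, hαC, by positivity, hsep, (div_lt_one (by linarith)).mpr hlam,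
    fun n => ?_⟩
  -- A single multiplier is bounded below by the N-fold product divided by the upper bounds of the
  -- other N - 1 factors.
  · obtain ⟨k, rfl⟩ := Nat.exists_eq_add_of_lt hN
    simp only [zero_add] at *
    rw [div_le_iff₀ (by positivity), Nat.add_sub_cancel]
    refine (hlow n).trans ?_
    rw [Finset.prod_range_succ', mul_comm]
    simp only [Nat.cast_zero, add_zero]
    gcongr
    calc _ ≤ ∏ i ∈ Finset.range k, max C 1 :=
          Finset.prod_le_prod (fun i _ => norm_nonneg _) fun i _ => hαC _
      _ = _ := by simp
  · rw [Finset.prod_div_distrib, div_le_div_iff₀ (hα0 n) (by linarith)]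
    linarith [hdom n]

/-! ### From a dominated splitting to invertibility -/

lemma isUnit_jacobiSub_of_dominatedSplitting (a : lp (fun _ : ℤ => ℂ) ∞)
    (b : lp (fun _ : ℤ => ℝ) ∞) (E : ℂ)
    (h : AdmitsDominatedSplitting (jacobiCocycle a b E)) : IsUnit (jacobiSub a b E) := by
  obtain ⟨u, s, α, β, N, θ, c, C, η, hu1, hs1, hα, hβ, hc, hαc, hαC, hη, hsep, hθ, hprod⟩ :=
    h.exists_frame
  set D : ℤ → ℂ := fun n => C2.wedge (u n) (s n) with hD
  have hDη : ∀ n, η ≤ ‖D n‖ := hsep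
  have hD2 : ∀ n, ‖D n‖ ≤ 2 := fun n => by simpa [hu1, hs1] using C2.norm_wedge_le (u n) (s n)
  have hD0 : ∀ n, D n ≠ 0 := fun n => norm_pos_iff.mp (hη.trans_le (hDη n))
  have hα0 : ∀ n, α n ≠ 0 := fun n => norm_pos_iff.mp (hc.trans_le (hαc n))
  have ha : ∀ n, ‖a n‖ ≤ ‖a‖ := fun n => lp.norm_apply_le_norm ENNReal.top_ne_zero a n
  have hui : ∀ n i, ‖u n i‖ ≤ 1 := fun n i => hu1 n ▸ C2.norm_apply_le _ _
  have hsi : ∀ n i, ‖s n i‖ ≤ 1 := fun n i => hs1 n ▸ C2.norm_apply_le _ _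
  have hC0 : 0 < C := hc.trans_le ((hαc 0).trans (hαC 0))
  have bu0 : ∀ n, (E - (b n : ℂ)) * u n 0 - conj (a (n - 1)) * u n 1 = α n * u (n + 1) 0 :=
    fun n => by
      have := congrArg (fun v : C2 => v 0) (hα n)
      simpa [jacobiCocycle_apply_zero] using this
  have bu1 : ∀ n, a n * u n 0 = α n * u (n + 1) 1 := fun n => by
    have := congrArg (fun v : C2 => v 1) (hα n)
    simpa [jacobiCocycle_apply_one] using this
  have bs0 : ∀ n, (E - (b n : ℂ)) * s n 0 - conj (a (n - 1)) * s n 1 = β n * s (n + 1) 0 :=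
    fun n => by
      have := congrArg (fun v : C2 => v 0) (hβ n)
      simpa [jacobiCocycle_apply_zero] using this
  have bs1 : ∀ n, a n * s n 0 = β n * s (n + 1) 1 := fun n => by
    have := congrArg (fun v : C2 => v 1) (hβ n)
    simpa [jacobiCocycle_apply_one] using this
  -- This is det B(n) computed in the frame; it yields |x||y| = |β|/|α|.
  have hdet : ∀ n, a n * conj (a (n - 1)) * D n = α n * β n * D (n + 1) := fun n => by
    simp only [hD, C2.wedge]
    linear_combination (a n * s n 0) * bu0 n - (a n * u n 0) * bs0 n
      + (-β n * s (n + 1) 0) * bu1 n + (α n * u (n + 1) 0) * bs1 n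
  set x : ℤ → ℂ := fun n => a n / α n * (D n / D (n + 1)) with hx
  set y : ℤ → ℂ := fun n => conj (a (n - 1)) / α n with hy
  have hyC : ∀ n, ‖y n‖ ≤ ‖a‖ / c * (2 / η + 1) := fun n => by
    have h1 : ‖y n‖ ≤ ‖a‖ / c := by
      simp only [hy, norm_div, RCLike.norm_conj]
      gcongr
      exacts [ha _, hαc n]
    exact h1.trans (le_mul_of_one_le_right (by positivity) (by simp; positivity))
  have hxC : ∀ n, ‖x n‖ ≤ ‖a‖ / c * (2 / η + 1) := fun n => by
    simp only [hx, norm_mul, norm_div]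
    gcongr
    · exact ha _
    · exact hαc n
    · have : ‖D n‖ / ‖D (n + 1)‖ ≤ 2 / η := by
        gcongr
        exacts [hD2 n, hDη _]
      linarith
  have hxy : ∀ n, ‖x n‖ * ‖y n‖ = ‖β n‖ / ‖α n‖ := fun n => by
    rw [← norm_mul, ← norm_div]
    congr 1
    simp only [hx, hy]
    have h1 := hdet n
    have h2 := hα0 n
    have h3 := hD0 (n + 1)
    field_simp
    linear_combination h1
  obtain ⟨L, hL⟩ := exists_prod_le_half (x := fun n => ‖x n‖) (y := fun n => ‖y n‖)
    (w := fun n => ‖D n‖ / ‖α n‖) (C := ‖a‖ / c * (2 / η + 1)) (m := η / C) (M := 2 / c) (θ := θ)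
    (N := N) (fun n => norm_nonneg _) (fun n => norm_nonneg _) hxC hyC (by positivity)
    (fun n => by
      have := norm_pos_iff.mpr (hα0 n)
      gcongr
      exacts [hDη n, hαC n])
    (fun n => by gcongr; exacts [hD2 n, hαc n])
    (fun n => by
      have h1 := norm_ne_zero_iff.mpr (hα0 n)
      have h2 := norm_ne_zero_iff.mpr (hα0 (n + 1))
      have h3 := norm_ne_zero_iff.mpr (hD0 (n + 1))
      simp only [hx, hy, norm_mul, norm_div, RCLike.norm_conj, add_sub_cancel_right]
      field_simp)
    hθ (fun n => by simpa only [hxy] using hprod n)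
  obtain ⟨K₁, hK₁, hP⟩ := weightedShift_sub_bounded_below x _ hxC 1 L
    (fun n => by simpa using (hL n).1)
  obtain ⟨K₂, hK₂, hQ⟩ := weightedShift_sub_bounded_below (fun n => y (n - 1)) _
    -- The backward shift runs through y(n-1), ..., y(n-L); reversing the order gives the forward
    -- window starting at n - L.
    (fun n => hyC (n - 1)) (-1) L (fun n => by
      rw [← Finset.prod_range_reflect]
      convert (hL (n - L)).2 using 1
      refine Finset.prod_congr rfl fun i hi => ?_
      have : i < L := Finset.mem_range.mp hi
      congr 2
      push_cast [show 1 ≤ L by omega, show i ≤ L - 1 by omega]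
      ring)
  set F : ℝ := 1 / η * (K₁ * (2 / η / c)) + 1 / η * (K₂ * (1 / c)) with hF
  have hF0 : 0 ≤ F := by positivity
  refine (jacobiSub_isStarNormal a b E).isUnit_of_bounded_below (c := 1 / (F + 1))
    (by positivity) fun ψ => ?_
  set f := jacobiSub a b E ψ with hf
  -- With v = (ψ(n), ψ(n-1)), P and Q are v ∧ s and u ∧ v, that is, D times the coordinates of v
  -- along u and s.
  set P : EllTwo := weightedShift (fun n => s n 1) 1 (fun n => hsi n 1) 0 ψ
    - weightedShift (fun n => s n 0) 1 (fun n => hsi n 0) (-1) ψ with hPdef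
  set Q : EllTwo := weightedShift (fun n => u n 0) 1 (fun n => hui n 0) (-1) ψ
    - weightedShift (fun n => u n 1) 1 (fun n => hui n 1) 0 ψ with hQdef
  have hPn : ∀ n, P n = s n 1 * ψ n - s n 0 * ψ (n - 1) := fun n => by
    change s n 1 * ψ (n + 0) - s n 0 * ψ (n + -1) = _
    rw [add_zero, ← sub_eq_add_neg n]
  have hQn : ∀ n, Q n = u n 0 * ψ (n - 1) - u n 1 * ψ n := fun n => by
    change u n 0 * ψ (n + -1) - u n 1 * ψ (n + 0) = _
    rw [add_zero, ← sub_eq_add_neg n]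
  have hfn : ∀ n, f n = conj (a (n - 1)) * ψ (n - 1) + a n * ψ (n + 1) + ((b n : ℂ) - E) * ψ n :=
    fun n => jacobiSub_apply a b E ψ n
  -- B(n)v(n) = a(n)v(n+1) - (f(n), 0); wedging with s(n+1) and dividing by α(n) gives the recursion
  -- for P.
  have hPf : ‖P - weightedShift x _ hxC 1 P‖ ≤ 2 / η / c * ‖f‖ := by
    have hb : ∀ n, ‖-(s (n + 1) 1 * (D n / D (n + 1)) / α n)‖ ≤ 2 / η / c := fun n => by
      rw [norm_neg, norm_div, norm_mul, norm_div]
      have h1 : ‖D n‖ / ‖D (n + 1)‖ ≤ 2 / η := by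
        gcongr
        exacts [hD2 n, hDη _]
      have h2 : ‖s (n + 1) 1‖ * (‖D n‖ / ‖D (n + 1)‖) ≤ 2 / η := by
        calc _ ≤ 1 * (2 / η) := by gcongr; exact hsi _ _
          _ = _ := one_mul _
      gcongr
      exact hαc n
    have e : P - weightedShift x _ hxC 1 P = weightedShift _ _ hb 0 f := by
      ext n
      change P n - x n * P (n + 1) = -(s (n + 1) 1 * (D n / D (n + 1)) / α n) * f (n + 0)
      rw [add_zero, hfn, hPn, hPn, add_sub_cancel_right]
      have h1 := hα0 n
      have h2 := hD0 (n + 1)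
      simp only [hx]
      field_simp
      simp only [hD, C2.wedge]
      linear_combination
        (s n 1 * ψ n - s n 0 * ψ (n - 1)) * (s (n + 1) 0 * bu1 n - s (n + 1) 1 * bu0 n)
        + (u n 0 * ψ (n - 1) - u n 1 * ψ n) * (s (n + 1) 0 * bs1 n - s (n + 1) 1 * bs0 n)
    rw [e]
    exact weightedShift_norm_le_opNorm _ _ _ _ _
  -- Wedging with u(n+1) would put the factor a(n) on Q(n+1). The Wronskian identity for u and ψ
  -- puts α(n) there instead, which may be divided out.
  have hQf : ‖Q - weightedShift (fun n => y (n - 1)) _ (fun n => hyC (n - 1)) (-1) Q‖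
      ≤ 1 / c * ‖f‖ := by
    have hb : ∀ n, ‖-(u (n - 1) 0 / α (n - 1))‖ ≤ 1 / c := fun n => by
      rw [norm_neg, norm_div]
      gcongr
      exacts [hui _ _, hαc _]
    have e : Q - weightedShift (fun n => y (n - 1)) _ (fun n => hyC (n - 1)) (-1) Q =
        weightedShift _ _ hb (-1) f := by
      ext k
      change Q k - y (k - 1) * Q (k + -1) = -(u (k - 1) 0 / α (k - 1)) * f (k + -1)
      obtain ⟨n, rfl⟩ : ∃ n, k = n + 1 := ⟨k - 1, by ring⟩
      rw [← sub_eq_add_neg, add_sub_cancel_right, hfn, hQn, hQn, add_sub_cancel_right]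
      have h1 := hα0 n
      simp only [hy]
      field_simp
      linear_combination ψ (n + 1) * bu1 n - ψ n * bu0 n
    rw [e]
    exact weightedShift_norm_le_opNorm _ _ _ _ _
  have hψ : ‖ψ‖ ≤ 1 / η * ‖P‖ + 1 / η * ‖Q‖ := by
    have hb1 : ∀ n, ‖u n 0 / D n‖ ≤ 1 / η := fun n => by
      rw [norm_div]
      gcongr
      exacts [hui _ _, hDη _]
    have hb2 : ∀ n, ‖s n 0 / D n‖ ≤ 1 / η := fun n => by
      rw [norm_div]
      gcongr
      exacts [hsi _ _, hDη _]
    have e : ψ = weightedShift _ _ hb1 0 P + weightedShift _ _ hb2 0 Q := by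
      ext n
      change ψ n = u n 0 / D n * P (n + 0) + s n 0 / D n * Q (n + 0)
      rw [add_zero, hPn, hQn]
      have h2 := hD0 n
      field_simp
      simp only [hD, C2.wedge]
      ring
    calc ‖ψ‖ = ‖weightedShift _ _ hb1 0 P + weightedShift _ _ hb2 0 Q‖ := by rw [← e]
      _ ≤ _ := (norm_add_le _ _).trans
        (add_le_add (weightedShift_norm_le_opNorm _ _ _ _ _) (weightedShift_norm_le_opNorm _ _ _ _ _))
  have h1 : ‖P‖ ≤ K₁ * (2 / η / c * ‖f‖) := (hP P).trans (by gcongr)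
  have h2 : ‖Q‖ ≤ K₂ * (1 / c * ‖f‖) := (hQ Q).trans (by gcongr)
  have h3 : ‖ψ‖ ≤ F * ‖f‖ :=
    calc ‖ψ‖ ≤ 1 / η * (K₁ * (2 / η / c * ‖f‖)) + 1 / η * (K₂ * (1 / c * ‖f‖)) :=
          hψ.trans (by gcongr)
      _ = _ := by rw [hF]; ring
  rw [one_div, inv_mul_eq_div, div_le_iff₀ (by positivity)]
  nlinarith [norm_nonneg f]

/-! ### Boundedness of the cocycle and the theorem -/

lemma exists_norm_jacobiCocycle_le (a : lp (fun _ : ℤ => ℂ) ∞) (b : lp (fun _ : ℤ => ℝ) ∞)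
    (E : ℂ) : ∃ C : ℝ, ∀ j,
      ‖Matrix.toEuclideanCLM (n := Fin 2) (𝕜 := ℂ) (jacobiCocycle a b E j)‖ ≤ C := by
  have ha : ∀ n, ‖a n‖ ≤ ‖a‖ := fun n => lp.norm_apply_le_norm ENNReal.top_ne_zero a n
  have hb : ∀ n, ‖(b n : ℂ)‖ ≤ ‖b‖ := fun n => by
    simpa using lp.norm_apply_le_norm ENNReal.top_ne_zero b n
  refine ⟨(‖E‖ + ‖b‖ + ‖a‖) + ‖a‖, fun j => ?_⟩
  refine ContinuousLinearMap.opNorm_le_bound _ (by positivity) fun v => ?_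
  set w : C2 := Matrix.toEuclideanCLM (n := Fin 2) (𝕜 := ℂ) (jacobiCocycle a b E j) v with hw
  have h0 : w 0 = (E - (b j : ℂ)) * v 0 - conj (a (j - 1)) * v 1 :=
    jacobiCocycle_apply_zero a b E j v
  have h1 : w 1 = a j * v 0 := jacobiCocycle_apply_one a b E j v
  have hv0 : ‖v 0‖ ≤ ‖v‖ := C2.norm_apply_le v 0
  have hv1 : ‖v 1‖ ≤ ‖v‖ := C2.norm_apply_le v 1
  have k0 : ‖w 0‖ ≤ (‖E‖ + ‖b‖ + ‖a‖) * ‖v‖ := by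
    rw [h0]
    calc _ ≤ ‖(E - (b j : ℂ)) * v 0‖ + ‖conj (a (j - 1)) * v 1‖ := norm_sub_le _ _
      _ ≤ (‖E‖ + ‖b‖) * ‖v‖ + ‖a‖ * ‖v‖ := by
        rw [norm_mul, norm_mul, RCLike.norm_conj]
        gcongr
        · exact (norm_sub_le _ _).trans (by gcongr; exact hb j)
        · exact ha _
      _ = _ := by ring
  have k1 : ‖w 1‖ ≤ ‖a‖ * ‖v‖ := by
    rw [h1, norm_mul]
    gcongr
    exact ha _
  have k2 : ‖w‖ ≤ ‖w 0‖ + ‖w 1‖ := by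
    refine le_of_sq_le_sq ?_ (by positivity)
    rw [C2.norm_sq]
    nlinarith [norm_nonneg (w 0), norm_nonneg (w 1)]
  linarith

theorem theorem1p6 :
    (∀ (a : lp (fun _ : ℤ => ℂ) ∞) (b : lp (fun _ : ℤ => ℝ) ∞),
      resolventSet ℂ (jacobiOp a b) =
        {E : ℂ | AdmitsDominatedSplitting (jacobiCocycle a b E)}) ∧
    (∀ M δ : ℝ, 0 < M → 0 < δ → ∃ (N : ℕ) (η : ℝ), 0 < N ∧ 0 < η ∧
      ∀ (a : lp (fun _ : ℤ => ℂ) ∞) (b : lp (fun _ : ℤ => ℝ) ∞) (E : ℂ),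
        ‖a‖ ≤ M → ‖b‖ ≤ M → ‖E‖ ≤ M →
        δ ≤ Metric.infDist E (spectrum ℂ (jacobiOp a b)) →
        ∃ Eu Es : ℤ → ℙ ℂ C2,
          IsDominatedSplitting (jacobiCocycle a b E) Eu Es N 2 η) := by
  refine ⟨fun a b => Set.ext fun E => ⟨fun hE => ?_, fun hE => ?_⟩, fun M δ _ hδ => ?_⟩
  -- Needed for a nonempty spectrum: the distance to the empty set is 0 by convention and would not
  -- be positive.
  · have : Nontrivial EllTwo :=
      ⟨lp.single 2 0 1, 0, fun h => by
        simpa using congrArg (fun φ : EllTwo => φ 0) h⟩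
    have hpos : 0 < Metric.infDist E (spectrum ℂ (jacobiOp a b)) :=
      ((spectrum.isClosed (𝕜 := ℂ) (jacobiOp a b)).notMem_iff_infDist_pos
        (spectrum.nonempty (jacobiOp a b))).mp (not_not.mpr hE)
    obtain ⟨N, η, hN, hη, h⟩ := exists_uniform_dominatedSplitting ‖a‖ _ hpos
    obtain ⟨Eu, Es, hDS⟩ := h a b E le_rfl le_rfl
    exact ⟨exists_norm_jacobiCocycle_le a b E, Eu, Es, N, 2, η, hN, by norm_num, hη, hDS⟩
  · exact (mem_resolventSet_iff_isUnit_jacobiSub a b E).mpr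
      (isUnit_jacobiSub_of_dominatedSplitting a b E hE)
  · obtain ⟨N, η, hN, hη, h⟩ := exists_uniform_dominatedSplitting M δ hδ
    exact ⟨N, η, hN, hη, fun a b E ha _ _ hE => h a b E ha hE⟩
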